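/- Let $\Gamma_1(4)=\{\begin{pmatrix}a&b\\c&d\end{pmatrix}\in\mathrm{SL}_2(\mathbb Z): 4\mid c,\ d\equiv1 \bmod 4\}$ and, for $\gamma=\begin{pmatrix}a&b\\c&d\end{pmatrix}\in\Gamma_1(4)$ and $z$ in the upper half plane $\mathcal H$, put $J(\gamma,z)=\left(\frac cd\right)(cz+d)^{1/2}$, where $\left(\frac cd\right)$ is the Kronecker symbol and the square root is the principal one. For $\kappa\in\frac12\mathbb Z_{\ge0}$ let $M_\kappa(4,1)$ be the space of holomorphic functions $f:\mathcal H\to\mathbb C$ with $f(\gamma z)=J(\gamma,z)^{2\kappa}f(z)$ for all $\gamma\in\Gamma_1(4)$ that are holomorphic at all cusps, i.e. $(cz+d)^{-\kappa}f(\alpha z)$ is bounded as $\operatorname{Im}z\to\infty$ for every $\alpha=\begin{pmatrix}a&b\\c&d\end{pmatrix}\in\mathrm{SL}_2(\mathbb Z)$. For integral $\kappa=k$ this is the usual space $M_k(\Gamma_1(4))$ of modular forms of weight $k$. With $q=e^{2\pi iz}$ put $$\vartheta=\sum_{n\in\mathbb Z}q^{n^2},\qquad \alpha_4=\sum_{n\ge1,\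 n\text{ odd}}\sigma_1(n)q^n,\qquad \sigma_1(n)=\sum_{d\mid n}d .$$ Then the sum of the spaces $M_\kappa(4,1)$, $\kappa\in\frac12\mathbb Z_{\ge0}$, inside the ring of functions on $\mathcal H$ is direct; $\vartheta\in M_{1/2}(4,1)$ and $\alpha_4\in M_2(4,1)$; and the graded ring $M_{\frac12\mathbb N}(4,1)=\bigoplus_{\kappa\in\frac12\mathbb Z_{\ge0}}M_\kappa(4,1)$ is the polynomial ring $\mathbb C[\vartheta,\alpha_4]$: the homomorphism of $\mathbb C$-algebras $\mathbb C[X,Y]\to M_{\frac12\mathbb N}(4,1)$ with $X\mapsto\vartheta$, $Y\mapsto\alpha_4$ is an isomorphism of graded rings, where $X$ has weight $\frac12$ and $Y$ has weight $2$. Moreover, for every integer $k\ge0$, $$M_{k+\frac12}(4,1)=M_k(4,1)\,\vartheta=\{g\vartheta : g\in M_k(\Gamma_1(4))\}.$$ -/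

import Mathlib

open UpperHalfPlane MatrixGroups CongruenceSubgroup
open scoped DirectSum ModularForm Manifold

noncomputable section

namespace HalfIntegralWeight

/-- The Kronecker symbol `(a / n)`: the completely multiplicative extension in `n` of the Jacobi
symbol, with `(a / 2) = 0, 1, -1` according as `a` is even, `a ≡ ±1 mod 8`, `a ≡ ±3 mod 8`,
`(a / -1) = -1` exactly when `a < 0`, and `(a / 0) = 1` exactly when `a = ±1` (else `0`). -/
def kroneckerSymbol (a n : ℤ) : ℤ :=
  if n = 0 then (if a.natAbs = 1 then 1 else 0)
  else (if a < 0 ∧ n < 0 then -1 else 1) * ZMod.χ₈ (a : ZMod 8) ^ padicValNat 2 n.natAbs *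
    jacobiSym a (n.natAbs / 2 ^ padicValNat 2 n.natAbs)

/-- `(c z + d) ^ (1/2)`, principal branch, where `(c, d)` is the lower row of `γ`. -/
def sqrtDenom (γ : SL(2, ℤ)) (z : ℍ) : ℂ :=
  ((γ 1 0 : ℂ) * z + (γ 1 1 : ℂ)) ^ (1 / 2 : ℂ)

/-- The theta automorphy factor `J(γ, z) = (c / d) (c z + d) ^ (1/2)`, of use for `γ ∈ Γ₀(4)`. -/
def J (γ : SL(2, ℤ)) (z : ℍ) : ℂ :=
  (kroneckerSymbol (γ 1 0) (γ 1 1) : ℂ) * sqrtDenom γ z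

/-- The weight `n / 2` operator `(f |_{n/2} γ)(z) = J(γ, z)⁻ⁿ f(γ z)`. -/
def slash (n : ℕ) (f : ℍ → ℂ) (γ : SL(2, ℤ)) (z : ℍ) : ℂ :=
  (J γ z ^ n)⁻¹ * f (γ • z)

/-- The space `M_{n/2}(Γ)` of modular forms of weight `n / 2` for `Γ ≤ Γ₁(4)`: holomorphic
functions on the upper half plane that are fixed by the weight `n / 2` operators of `Γ` and
holomorphic at all cusps `α ∞`, `α ∈ SL₂(ℤ)`, i.e. `(c z + d)^(-n/2) f(α z)` stays bounded as
`Im z → ∞`. The index `n : ℕ` is twice the weight. -/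
def M (Γ : Subgroup SL(2, ℤ)) (n : ℕ) : Submodule ℂ (ℍ → ℂ) where
  carrier := {f | MDiff f ∧ (∀ γ ∈ Γ, slash n f γ = f) ∧
    ∀ α : SL(2, ℤ), IsBoundedAtImInfty fun z => (sqrtDenom α z ^ n)⁻¹ * f (α • z)}
  zero_mem' := by
    refine ⟨mdifferentiable_const, fun γ _ => ?_, fun α => ?_⟩
    · ext z; simp [slash]
    · simpa using! Filter.zero_zeroAtFilter (β := ℂ) atImInfty |>.boundedAtFilter
  add_mem' := by
    rintro f g ⟨hf, hf', hf''⟩ ⟨hg, hg', hg''⟩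
    refine ⟨hf.add hg, fun γ hγ => ?_, fun α => ?_⟩
    · ext z
      have h1 := congrFun (hf' γ hγ) z
      have h2 := congrFun (hg' γ hγ) z
      simp only [slash, Pi.add_apply, mul_add] at h1 h2 ⊢
      rw [h1, h2]
    · have := (hf'' α).add (hg'' α)
      simpa only [Pi.add_apply, mul_add] using! this
  smul_mem' := by
    rintro c f ⟨hf, hf', hf''⟩
    refine ⟨hf.const_smul c, fun γ hγ => ?_, fun α => ?_⟩
    · ext z
      have h1 := congrFun (hf' γ hγ) z
      simp only [slash, Pi.smul_apply, smul_eq_mul] at h1 ⊢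
      rw [mul_left_comm, h1]
    · have := (hf'' α).smul c
      refine this.congr_left fun z => ?_
      simp only [Pi.smul_apply, smul_eq_mul]
      ring

/-- `M_{m/2}(Γ) M_{n/2}(Γ) ⊆ M_{(m+n)/2}(Γ)`, so that `⨁ n, M Γ n` is a graded `ℂ`-algebra. -/
instance (Γ : Subgroup SL(2, ℤ)) : SetLike.GradedMonoid (M Γ) where
  one_mem := by
    refine ⟨mdifferentiable_const, fun γ _ => ?_, fun α => ?_⟩
    · ext z; simp [slash]
    · simpa using! Filter.const_boundedAtFilter atImInfty (1 : ℂ)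
  mul_mem := by
    rintro m n f g ⟨hf, hf', hf''⟩ ⟨hg, hg', hg''⟩
    refine ⟨hf.mul hg, fun γ hγ => ?_, fun α => ?_⟩
    · ext z
      have h1 := congrFun (hf' γ hγ) z
      have h2 := congrFun (hg' γ hγ) z
      simp only [slash, Pi.mul_apply] at h1 h2 ⊢
      rw [pow_add, mul_inv, mul_mul_mul_comm, h1, h2]
    · have := (hf'' α).mul (hg'' α)
      refine this.congr_left fun z => ?_
      simp only [Pi.mul_apply, pow_add, mul_inv]
      ring

/-- The Jacobi theta series `ϑ = ∑_{n ∈ ℤ} q^(n²)`, where `q = exp(2πiz)`. -/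
def theta (z : ℍ) : ℂ :=
  ∑' n : ℤ, Complex.exp (2 * Real.pi * Complex.I * z) ^ n.natAbs ^ 2

/-- The series `α₄ = ∑_{n odd} σ₁(n) qⁿ` over the odd positive integers, where `q = exp(2πiz)`. -/
def alpha4 (z : ℍ) : ℂ :=
  ∑' m : ℕ, (ArithmeticFunction.sigma 1 (2 * m + 1) : ℂ) *
    Complex.exp (2 * Real.pi * Complex.I * z) ^ (2 * m + 1)

end HalfIntegralWeight

end

/-! The form `alpha4` has no zero on the upper half plane, a simple zero in `q` at `∞`, and no zero
at the other cusps, while `theta` tends to `1` at `∞`. So if `f` has weight `n / 2` and value `a` at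
`∞`, then `f - a • theta ^ n` vanishes at `∞` and is divisible by `alpha4`, with a quotient of
weight `(n - 4) / 2`. For `n < 4` the square of the quotient has negative integral weight and is
therefore zero. Induction on `n` (`exists_eq_add`, `exists_homogeneous_aeval_eq`) shows that `theta`
and `alpha4` generate. The same induction over odd `n` yields the factor `theta`
(`exists_eq_mul_theta`).

The divisor of `alpha4` comes from `exists_alpha4_pow_six_eq`: the ratio of `alpha4 ^ 6` to the eta
quotient `Δ(4z)² / Δ(2z)` has weight `0` and is bounded at every cusp, hence is constant, and `Δ`
has no zeros.

Membership of `theta` (`theta_smul`) rests on generation of `Γ₁(4)` by `T` and `V`: the factor `J`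
satisfies the cocycle relation for right multiplication by either, and `theta` transforms correctly
under both. For `alpha4`, a combination of `E2(z)`, `E2(2z)`, `E2(4z)` is taken in which the
non-modular terms cancel. Boundedness at the cusps follows from polynomial growth in `1 / Im z`.

The sum of the spaces is direct because, at fixed `z`, `J(γ, z)` takes infinitely many values
(`eq_zero_of_sum_eq_zero`). Algebraic independence follows by dividing a relation of fixed weight by
its lowest power of `alpha4` and passing to the limit at `∞`. -/

namespace HalfIntegralWeight

/-! ### Periodicity and sign rules of the Kronecker symbol. -/

section KroneckerSymbol

theorem kroneckerSymbol_of_odd (a : ℤ) {n : ℤ} (hn : n % 2 = 1) :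
    kroneckerSymbol a n = (if a < 0 ∧ n < 0 then -1 else 1) * jacobiSym a n.natAbs := by
  have h0 : n ≠ 0 := by rintro rfl; simp at hn
  have h2 : padicValNat 2 n.natAbs = 0 := padicValNat.eq_zero_of_not_dvd (by omega)
  simp [kroneckerSymbol, h0, h2]

theorem kroneckerSymbol_sq {a n : ℤ} (hn : n % 2 = 1) (h : a.gcd n = 1) :
    kroneckerSymbol a n ^ 2 = 1 := by
  rw [kroneckerSymbol_of_odd a hn, mul_pow, jacobiSym.sq_one (by rw [Int.gcd, Int.natAbs_natCast]; exact h)]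
  split_ifs <;> simp

theorem kroneckerSymbol_one_right (a : ℤ) : kroneckerSymbol a 1 = 1 := by
  rw [kroneckerSymbol_of_odd a (by norm_num)]
  simp

theorem jacobiSym_add_four_mul (a : ℕ) {m : ℕ} (hm : Odd m) :
    jacobiSym a (m + 4 * a) = jacobiSym a m := by
  have h : Odd (m + 4 * a) := hm.add_even ⟨2 * a, by ring⟩
  rw [jacobiSym.mod_right' a h, jacobiSym.mod_right' a hm, Nat.add_mod_right]

/-- Put `a = 2 ^ k * m` with `m` odd and `b = 4a - 1 ≡ 3 mod 4`. Since `b ≡ -1 mod m`, the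
reciprocity sign cancels `(-1 / m)`; if `k > 0`, then `b ≡ 7 mod 8` and `(2 / b) = 1`. -/
theorem jacobiSym_four_mul_sub_one {a : ℕ} (ha : 0 < a) : jacobiSym a (4 * a - 1) = 1 := by
  obtain ⟨k, m, hm, rfl⟩ := Nat.exists_eq_two_pow_mul_odd ha.ne'
  set b := 4 * (2 ^ k * m) - 1 with hb
  have hb4 : b % 4 = 3 := by omega
  have hbodd : Odd b := Nat.odd_iff.2 (by omega)
  have hmb : jacobiSym m b = 1 := by
    rw [← jacobiSym.quadratic_reciprocity_if (Nat.odd_iff.1 hm) (by omega)]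
    have h1 : jacobiSym b m = jacobiSym (-1) m := by
      apply jacobiSym.mod_left'
      apply Int.ModEq.symm
      rw [Int.modEq_iff_dvd]
      refine ⟨4 * 2 ^ k, ?_⟩
      have : (b : ℤ) = 4 * (2 ^ k * m) - 1 := by
        rw [hb, Nat.cast_sub (by omega)]; push_cast; ring
      rw [this]; ring
    rw [h1, jacobiSym.at_neg_one hm, ZMod.χ₄_nat_eq_if_mod_four]
    have := Nat.odd_iff.1 hm
    by_cases h3 : m % 4 = 3
    · have : m % 4 ≠ 1 := by omega
      simp [h3, hb4]; omega
    · have : m % 4 = 1 := by omega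
      simp [this]; omega
  push_cast
  rw [jacobiSym.mul_left, hmb, mul_one, jacobiSym.pow_left]
  rcases k with _ | k
  · simp
  · have hb8 : b % 8 = 7 := by
      have : 2 ^ (k + 1) * m = 2 * (2 ^ k * m) := by ring
      omega
    rw [jacobiSym.at_two hbodd, ZMod.χ₈_nat_eq_if_mod_eight]
    simp [hb8]; omega

/-- The symbol has period `4a` in the denominator, and `4a - m ≡ m (4a - 1) mod 4a`. -/
theorem jacobiSym_four_mul_sub {a m : ℕ} (hm : Odd m) (h : m < 4 * a) :
    jacobiSym a (4 * a - m) = jacobiSym a m := by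
  have hm0 : m ≠ 0 := by rintro rfl; simp at hm
  have hodd : Odd (4 * a - m) := by
    rw [Nat.odd_iff] at hm ⊢; omega
  have hodd1 : Odd (4 * a - 1) := by rw [Nat.odd_iff]; omega
  have h1 : jacobiSym a (m * (4 * a - 1)) = jacobiSym a m := by
    rw [jacobiSym.mul_right' _ hm0 (by omega), jacobiSym_four_mul_sub_one (by omega), mul_one]
  rw [← h1, jacobiSym.mod_right' a hodd, jacobiSym.mod_right' a (hm.mul hodd1)]
  congr 1
  have : (4 * a - m) + m ≡ m * (4 * a - 1) + m [MOD 4 * a] := by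
    have e : m * (4 * a - 1) + m = 4 * a * m := by
      obtain ⟨t, ht⟩ : ∃ t, 4 * a = t + 1 := ⟨4 * a - 1, by omega⟩
      rw [ht]; simp; ring
    rw [e, Nat.sub_add_cancel h.le]
    simp [Nat.ModEq]
  exact Nat.ModEq.add_right_cancel' m this

/-- For `c < 0` the factor `(-1 / |d|)` is `-1` exactly when `d < 0`, as `d ≡ 1 mod 4`; the sign
convention of the Kronecker symbol cancels it. -/
theorem kroneckerSymbol_eq_natAbs (c : ℤ) {d : ℤ} (hd : d % 4 = 1) :
    kroneckerSymbol c d = jacobiSym c.natAbs d.natAbs := by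
  rw [kroneckerSymbol_of_odd c (by omega)]
  rcases le_or_gt 0 c with hc | hc
  · rw [if_neg (by omega), one_mul, Int.natAbs_of_nonneg hc]
  · have hc' : c = -(c.natAbs : ℤ) := by omega
    conv_lhs => rw [show jacobiSym c d.natAbs = jacobiSym (-(c.natAbs : ℤ)) d.natAbs by rw [← hc']]
    rw [jacobiSym.neg _ (Nat.odd_iff.2 (by omega)), ZMod.χ₄_nat_eq_if_mod_four]
    rcases le_or_gt 0 d with h | h
    · rw [if_neg (by omega), if_neg (by omega), if_pos (by omega)]; simp
    · rw [if_pos ⟨hc, h⟩, if_neg (by omega), if_neg (by omega)]; simp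

theorem kroneckerSymbol_add_self {c d : ℤ} (hc : c % 4 = 0) (hd : d % 4 = 1) :
    kroneckerSymbol c (d + c) = kroneckerSymbol c d := by
  rw [kroneckerSymbol_eq_natAbs c hd, kroneckerSymbol_eq_natAbs c (by omega)]
  obtain ⟨a, ha⟩ : ∃ a : ℕ, c.natAbs = 4 * a := ⟨c.natAbs / 4, by omega⟩
  have key (b : ℕ) (hb : b % 2 = 1) : jacobiSym c.natAbs b = jacobiSym a b := by
    rw [← jacobiSym.div_four_left (by omega) hb]; congr 1; omega
  rw [key _ (by omega), key _ (by omega)]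
  have hodd : Odd d.natAbs := Nat.odd_iff.2 (by omega)
  have hodd' : Odd (d + c).natAbs := Nat.odd_iff.2 (by omega)
  have h3 : (d + c).natAbs = d.natAbs + 4 * a ∨ d.natAbs = (d + c).natAbs + 4 * a ∨
      ((d + c).natAbs = 4 * a - d.natAbs ∧ d.natAbs < 4 * a) := by omega
  rcases h3 with h | h | ⟨h, h'⟩
  · rw [h, jacobiSym_add_four_mul a hodd]
  · rw [h, jacobiSym_add_four_mul a hodd']
  · rw [h, jacobiSym_four_mul_sub hodd h']

/-- The Jacobi part depends only on `c` modulo `d`. The sign that remains is matched in `J_mul_V` by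
a jump of the principal square root. -/
theorem kroneckerSymbol_add_four_mul {c d : ℤ} (hd : d % 4 = 1) :
    kroneckerSymbol (c + 4 * d) d =
      (if c + 4 * d < 0 ∧ 0 ≤ c then -1 else 1) * kroneckerSymbol c d := by
  rw [kroneckerSymbol_of_odd _ (by omega), kroneckerSymbol_of_odd _ (by omega)]
  have : jacobiSym (c + 4 * d) d.natAbs = jacobiSym c d.natAbs := by
    apply jacobiSym.mod_left'
    apply Int.ModEq.symm
    rw [Int.modEq_iff_dvd]
    simp only [add_sub_cancel_left, Int.natCast_natAbs, abs_dvd]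
    exact dvd_mul_left _ _
  rw [this, ← mul_assoc]
  congr 1
  split_ifs <;> first | rfl | omega

end KroneckerSymbol

/-! ### Multiplicativity of the principal square root, up to sign. -/

section SquareRoot

open Complex

theorem cpow_half_sq (w : ℂ) : (w ^ (1 / 2 : ℂ)) ^ 2 = w := by
  rw [one_div]; exact cpow_ofNat_inv_pow w 2

theorem cpow_half_re_nonneg (w : ℂ) : 0 ≤ (w ^ (1 / 2 : ℂ)).re := by
  rw [one_div, cpow_inv_two_re]; exact Real.sqrt_nonneg _

theorem cpow_half_im_nonneg {w : ℂ} (h : 0 ≤ w.im) : 0 ≤ (w ^ (1 / 2 : ℂ)).im := by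
  rw [one_div, cpow_inv_two_im_eq_sqrt h]; exact Real.sqrt_nonneg _

theorem cpow_half_im_nonpos {w : ℂ} (h : w.im < 0) : (w ^ (1 / 2 : ℂ)).im ≤ 0 := by
  rw [one_div, cpow_inv_two_im_eq_neg_sqrt h]; exact neg_nonpos.2 (Real.sqrt_nonneg _)

theorem im_eq_cpow_half (w : ℂ) :
    w.im = 2 * (w ^ (1 / 2 : ℂ)).re * (w ^ (1 / 2 : ℂ)).im := by
  conv_lhs => rw [← cpow_half_sq w, sq, mul_im]
  ring

theorem re_eq_cpow_half (w : ℂ) :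
    w.re = (w ^ (1 / 2 : ℂ)).re ^ 2 - (w ^ (1 / 2 : ℂ)).im ^ 2 := by
  conv_lhs => rw [← cpow_half_sq w, sq, mul_re]
  ring

theorem cpow_half_mul_eq_or (u v : ℂ) :
    u ^ (1 / 2 : ℂ) * v ^ (1 / 2 : ℂ) = (u * v) ^ (1 / 2 : ℂ) ∨
      u ^ (1 / 2 : ℂ) * v ^ (1 / 2 : ℂ) = -(u * v) ^ (1 / 2 : ℂ) := by
  apply sq_eq_sq_iff_eq_or_eq_neg.1
  rw [mul_pow, cpow_half_sq, cpow_half_sq, cpow_half_sq]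

theorem cpow_half_mul_of_re_pos {u v : ℂ}
    (h : 0 < (u ^ (1 / 2 : ℂ) * v ^ (1 / 2 : ℂ)).re) :
    u ^ (1 / 2 : ℂ) * v ^ (1 / 2 : ℂ) = (u * v) ^ (1 / 2 : ℂ) := by
  refine (cpow_half_mul_eq_or u v).resolve_right fun h' => ?_
  rw [h', neg_re] at h
  linarith [cpow_half_re_nonneg (u * v)]

/-- The arguments of the two roots lie in `(-π/2, 0)` and `(0, π/2)`, so their product has positive
real part and is itself principal. -/
theorem cpow_half_mul_of_im_neg_of_im_pos {u v : ℂ} (hu : u.im < 0) (hv : 0 < v.im) :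
    u ^ (1 / 2 : ℂ) * v ^ (1 / 2 : ℂ) = (u * v) ^ (1 / 2 : ℂ) := by
  apply cpow_half_mul_of_re_pos
  have h1 := im_eq_cpow_half u
  have h2 := im_eq_cpow_half v
  have h3 := cpow_half_re_nonneg u
  have h4 := cpow_half_re_nonneg v
  rw [mul_re]
  set a := u ^ (1 / 2 : ℂ)
  set b := v ^ (1 / 2 : ℂ)
  have ha : 0 < a.re := lt_of_le_of_ne h3 fun h => by rw [← h] at h1; simp at h1; linarith
  have hb : 0 < b.re := lt_of_le_of_ne h4 fun h => by rw [← h] at h2; simp at h2; linarith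
  have ha' : a.im < 0 := by by_contra h; nlinarith [mul_nonneg ha.le (not_lt.1 h)]
  have hb' : 0 < b.im := by by_contra h; nlinarith [mul_nonneg hb.le (neg_nonneg.2 (not_lt.1 h))]
  nlinarith [mul_pos ha hb, mul_pos (neg_pos.2 ha') hb']

theorem cpow_half_mul_of_re_pos_of_re_pos {u v : ℂ} (hu : 0 < u.re) (hv : 0 < v.re) :
    u ^ (1 / 2 : ℂ) * v ^ (1 / 2 : ℂ) = (u * v) ^ (1 / 2 : ℂ) := by
  apply cpow_half_mul_of_re_pos
  have h1 := re_eq_cpow_half u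
  have h2 := re_eq_cpow_half v
  have h3 := cpow_half_re_nonneg u
  have h4 := cpow_half_re_nonneg v
  rw [mul_re]
  set a := u ^ (1 / 2 : ℂ)
  set b := v ^ (1 / 2 : ℂ)
  have ha : |a.im| < a.re := abs_lt_of_sq_lt_sq (by linarith) h3
  have hb : |b.im| < b.re := abs_lt_of_sq_lt_sq (by linarith) h4
  have : a.im * b.im < a.re * b.re := by
    calc a.im * b.im ≤ |a.im| * |b.im| := by rw [← abs_mul]; exact le_abs_self _
      _ < a.re * b.re := mul_lt_mul'' ha hb (abs_nonneg _) (abs_nonneg _)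
  linarith

/-- The product of the two roots has positive imaginary part, whereas the imaginary part of the
principal root of `u * v` has the sign of `(u * v).im`. -/
theorem cpow_half_mul_of_im_pos_of_im_pos {u v : ℂ} (hu : 0 < u.im) (hv : 0 < v.im) :
    (u * v) ^ (1 / 2 : ℂ) =
      (if (u * v).im < 0 then -1 else 1) * (u ^ (1 / 2 : ℂ) * v ^ (1 / 2 : ℂ)) := by
  have h1 := im_eq_cpow_half u
  have h2 := im_eq_cpow_half v
  have h3 := cpow_half_re_nonneg u
  have h4 := cpow_half_re_nonneg v
  have hs : 0 < (u ^ (1 / 2 : ℂ) * v ^ (1 / 2 : ℂ)).im := by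
    rw [mul_im]
    set a := u ^ (1 / 2 : ℂ)
    set b := v ^ (1 / 2 : ℂ)
    have ha : 0 < a.re := lt_of_le_of_ne h3 fun h => by rw [← h] at h1; simp at h1; linarith
    have hb : 0 < b.re := lt_of_le_of_ne h4 fun h => by rw [← h] at h2; simp at h2; linarith
    have ha' : 0 < a.im := by by_contra h; nlinarith [mul_nonneg ha.le (neg_nonneg.2 (not_lt.1 h))]
    have hb' : 0 < b.im := by by_contra h; nlinarith [mul_nonneg hb.le (neg_nonneg.2 (not_lt.1 h))]
    positivity
  split_ifs with h
  · rcases cpow_half_mul_eq_or u v with h' | h'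
    · rw [h'] at hs
      linarith [cpow_half_im_nonpos h]
    · rw [h']; ring
  · rcases cpow_half_mul_eq_or u v with h' | h'
    · rw [h']; ring
    · rw [h', neg_im] at hs
      linarith [cpow_half_im_nonneg (not_lt.1 h)]

end SquareRoot

/-! ### Cocycle relations of `J` for right multiplication by `T` and `V`. -/

section AutomorphyFactor

open Matrix.SpecialLinearGroup

/-- The parabolic element `(1 0; 4 1)`, which generates the stabiliser of the cusp `0`
in `Γ₁(4)`. -/
def V : SL(2, ℤ) := ⟨!![1, 0; 4, 1], by simp [Matrix.det_fin_two]⟩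

theorem mem_Gamma1_four {γ : SL(2, ℤ)} :
    γ ∈ Gamma1 4 ↔ γ 1 0 % 4 = 0 ∧ γ 1 1 % 4 = 1 := by
  rw [Gamma1_mem]
  have hdet := Matrix.det_fin_two γ.1
  rw [γ.2] at hdet
  have hc (x : ℤ) : ((x : ZMod 4) = 0) ↔ x % 4 = 0 := by
    rw [ZMod.intCast_zmod_eq_zero_iff_dvd]; push_cast; omega
  have h1 (x : ℤ) : ((x : ZMod 4) = 1) ↔ x % 4 = 1 := by
    rw [← Int.cast_one, ZMod.intCast_eq_intCast_iff, Int.ModEq]; push_cast; omega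
  rw [hc, h1, h1]
  refine ⟨fun h => ⟨h.2.2, h.2.1⟩, fun h => ⟨?_, h.2, h.1⟩⟩
  obtain ⟨c', hc'⟩ : ∃ c', γ 1 0 = 4 * c' := ⟨γ 1 0 / 4, by omega⟩
  obtain ⟨d', hd'⟩ : ∃ d', γ 1 1 = 4 * d' + 1 := ⟨γ 1 1 / 4, by omega⟩
  have : (γ 0 0 : ℤ) = 1 + 4 * (γ 0 1 * c' - γ 0 0 * d') := by
    change (1 : ℤ) = γ 0 0 * γ 1 1 - γ 0 1 * γ 1 0 at hdet
    rw [hc', hd'] at hdet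
    linarith
  omega

theorem lower_row_mul (γ δ : SL(2, ℤ)) (j : Fin 2) :
    (γ * δ) 1 j = γ 1 0 * δ 0 j + γ 1 1 * δ 1 j := by
  simp [Matrix.mul_apply, Fin.sum_univ_two]

theorem gcd_lower_row (γ : SL(2, ℤ)) : (γ 1 0).gcd (γ 1 1) = 1 := by
  rw [← Int.isCoprime_iff_gcd_eq_one]
  have hdet := Matrix.det_fin_two γ.1
  rw [γ.2] at hdet
  exact ⟨-γ 0 1, γ 0 0, by linear_combination -hdet⟩

theorem denom_ne_zero' (γ : SL(2, ℤ)) (z : ℍ) : (γ 1 0 : ℂ) * z + (γ 1 1 : ℂ) ≠ 0 := by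
  have := denom_ne_zero (γ : GL (Fin 2) ℝ) z
  rwa [ModularGroup.denom_apply] at this

theorem coe_smul_SL (γ : SL(2, ℤ)) (z : ℍ) :
    ((γ • z : ℍ) : ℂ) = ((γ 0 0 : ℂ) * z + γ 0 1) / ((γ 1 0 : ℂ) * z + γ 1 1) := by
  rw [coe_specialLinearGroup_apply]; simp

theorem sqrtDenom_sq (γ : SL(2, ℤ)) (z : ℍ) :
    sqrtDenom γ z ^ 2 = (γ 1 0 : ℂ) * z + (γ 1 1 : ℂ) := cpow_half_sq _

theorem sqrtDenom_ne_zero (γ : SL(2, ℤ)) (z : ℍ) : sqrtDenom γ z ≠ 0 := fun h => by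
  have := sqrtDenom_sq γ z
  rw [h] at this
  exact denom_ne_zero' γ z (by simpa using this.symm)

theorem kroneckerSymbol_lower_row_sq {γ : SL(2, ℤ)} (hγ : γ ∈ Gamma1 4) :
    kroneckerSymbol (γ 1 0) (γ 1 1) ^ 2 = 1 :=
  kroneckerSymbol_sq (by have := mem_Gamma1_four.1 hγ; omega) (gcd_lower_row γ)

theorem J_sq {γ : SL(2, ℤ)} (hγ : γ ∈ Gamma1 4) (z : ℍ) :
    J γ z ^ 2 = (γ 1 0 : ℂ) * z + (γ 1 1 : ℂ) := by
  rw [J, mul_pow, sqrtDenom_sq, ← Int.cast_pow, kroneckerSymbol_lower_row_sq hγ]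
  simp

theorem J_ne_zero {γ : SL(2, ℤ)} (hγ : γ ∈ Gamma1 4) (z : ℍ) : J γ z ≠ 0 := fun h => by
  have := J_sq hγ z
  rw [h] at this
  exact denom_ne_zero' γ z (by simpa using this.symm)

theorem T_mem : ModularGroup.T ∈ Gamma1 4 := by
  rw [mem_Gamma1_four]; simp [ModularGroup.T]

theorem V_mem : V ∈ Gamma1 4 := by
  rw [mem_Gamma1_four]; simp [V]

theorem J_mul_T {γ : SL(2, ℤ)} (hγ : γ ∈ Gamma1 4) (z : ℍ) :
    J (γ * ModularGroup.T) z = J γ (ModularGroup.T • z) := by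
  obtain ⟨hc, hd⟩ := mem_Gamma1_four.1 hγ
  have e0 : (γ * ModularGroup.T) 1 0 = γ 1 0 := by rw [lower_row_mul]; simp [ModularGroup.T]
  have e1 : (γ * ModularGroup.T) 1 1 = γ 1 1 + γ 1 0 := by
    rw [lower_row_mul]; simp [ModularGroup.T, add_comm]
  have e2 : ((ModularGroup.T • z : ℍ) : ℂ) = z + 1 := by
    rw [coe_smul_SL]; simp [ModularGroup.T]
  rw [J, J, sqrtDenom, sqrtDenom, e0, e1, e2, kroneckerSymbol_add_self hc hd]
  congr 2
  push_cast; ring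

theorem J_V (z : ℍ) : J V z = (4 * z + 1 : ℂ) ^ (1 / 2 : ℂ) := by
  simp [J, sqrtDenom, V, kroneckerSymbol_one_right]

theorem coe_V_smul (z : ℍ) : ((V • z : ℍ) : ℂ) = z / (4 * z + 1) := by
  rw [coe_smul_SL]; simp [V]

theorem J_mul_V {γ : SL(2, ℤ)} (hγ : γ ∈ Gamma1 4) (z : ℍ) :
    J (γ * V) z = J γ (V • z) * J V z := by
  obtain ⟨hc, hd⟩ := mem_Gamma1_four.1 hγ
  have e0 : (γ * V) 1 0 = γ 1 0 + 4 * γ 1 1 := by rw [lower_row_mul]; simp [V]; ring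
  have e1 : (γ * V) 1 1 = γ 1 1 := by rw [lower_row_mul]; simp [V]
  have hV0 : (4 * z + 1 : ℂ) ≠ 0 := by simpa [V] using denom_ne_zero' V z
  rw [J_V, J, J, sqrtDenom, sqrtDenom, e0, e1, kroneckerSymbol_add_four_mul hd]
  set c := γ 1 0
  set d := γ 1 1
  have huv : ((c : ℂ) * (V • z : ℍ) + d) * (4 * z + 1) = ((c + 4 * d : ℤ) : ℂ) * z + d := by
    rw [coe_V_smul, add_mul, mul_assoc, div_mul_cancel₀ _ hV0]; push_cast; ring
  have hv : 0 < (4 * z + 1 : ℂ).im := by simp [z.im_pos]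
  have hu : ((c : ℂ) * (V • z : ℍ) + d).im = c * (V • z : ℍ).im := by simp
  have huvim : (((c + 4 * d : ℤ) : ℂ) * z + d).im = ((c + 4 * d : ℤ) : ℝ) * z.im := by simp
  rw [← huv]
  -- The sign of `c` decides which half plane contains `c (V • z) + d`, and so which rule for
  -- products of square roots applies. Only `c > 0` can produce a sign, and it is the one from the
  -- Kronecker symbol.
  rcases lt_trichotomy c 0 with h | h | h
  · rw [← cpow_half_mul_of_im_neg_of_im_pos _ hv, if_neg (by omega)]
    · push_cast; ring
    · rw [hu]; exact mul_neg_of_neg_of_pos (by exact_mod_cast h) (V • z).im_pos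
  · have hd1 : d = 1 := by
      have := gcd_lower_row γ
      change Int.gcd c d = 1 at this
      rw [h] at this; simp at this; omega
    simp [h, hd1]
  · have hsign : (((c : ℂ) * (V • z : ℍ) + d) * (4 * z + 1)).im < 0 ↔ c + 4 * d < 0 := by
      rw [huv, huvim, ← Int.cast_lt_zero (R := ℝ)]
      exact ⟨fun h' => by by_contra h0; nlinarith [z.im_pos, mul_nonneg (not_lt.1 h0) z.im_pos.le],
        fun h' => mul_neg_of_neg_of_pos h' z.im_pos⟩
    rw [cpow_half_mul_of_im_pos_of_im_pos _ hv]
    · by_cases hs : c + 4 * d < 0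
      · rw [if_pos ⟨hs, h.le⟩, if_pos (hsign.2 hs)]; push_cast; ring
      · rw [if_neg (by omega), if_neg (mt hsign.1 hs)]; push_cast; ring
    · rw [hu]; exact mul_pos (by exact_mod_cast h) (V • z).im_pos

end AutomorphyFactor

/-! ### Polynomial growth towards the real line implies boundedness at the cusps. -/

section Growth

theorem denom_mul (γ δ : SL(2, ℤ)) (z : ℍ) :
    ((γ * δ) 1 0 : ℂ) * z + ((γ * δ) 1 1 : ℂ) =
      ((γ 1 0 : ℂ) * (δ • z : ℍ) + γ 1 1) * ((δ 1 0 : ℂ) * z + δ 1 1) := by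
  have h := denom_ne_zero' δ z
  rw [lower_row_mul, lower_row_mul, coe_smul_SL, add_mul, mul_assoc, div_mul_cancel₀ _ h]
  push_cast; ring

theorem norm_J {γ : SL(2, ℤ)} (hγ : γ ∈ Gamma1 4) (z : ℍ) : ‖J γ z‖ = ‖sqrtDenom γ z‖ := by
  have h : ‖J γ z‖ ^ 2 = ‖sqrtDenom γ z‖ ^ 2 := by
    rw [← norm_pow, ← norm_pow, J_sq hγ, sqrtDenom_sq]
  exact (sq_eq_sq₀ (norm_nonneg _) (norm_nonneg _)).1 h

theorem norm_sqrtDenom_mul (γ δ : SL(2, ℤ)) (z : ℍ) :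
    ‖sqrtDenom (γ * δ) z‖ = ‖sqrtDenom γ (δ • z)‖ * ‖sqrtDenom δ z‖ := by
  have h : ‖sqrtDenom (γ * δ) z‖ ^ 2 = (‖sqrtDenom γ (δ • z)‖ * ‖sqrtDenom δ z‖) ^ 2 := by
    rw [mul_pow, ← norm_pow, ← norm_pow, ← norm_pow, sqrtDenom_sq, sqrtDenom_sq, sqrtDenom_sq,
      denom_mul, norm_mul]
  exact (sq_eq_sq₀ (norm_nonneg _) (by positivity)).1 h

theorem apply_smul_of_slash_eq {n : ℕ} {f : ℍ → ℂ} {γ : SL(2, ℤ)} (hγ : γ ∈ Gamma1 4)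
    (h : slash n f γ = f) (z : ℍ) : f (γ • z) = J γ z ^ n * f z := by
  have h1 := congrFun h z
  rw [slash, inv_mul_eq_iff_eq_mul₀ (pow_ne_zero _ (J_ne_zero hγ z))] at h1
  exact h1

theorem slash_eq_of_apply_smul {n : ℕ} {f : ℍ → ℂ} {γ : SL(2, ℤ)} (hγ : γ ∈ Gamma1 4)
    (h : ∀ z, f (γ • z) = J γ z ^ n * f z) : slash n f γ = f := by
  ext z
  rw [slash, inv_mul_eq_iff_eq_mul₀ (pow_ne_zero _ (J_ne_zero hγ z)), h]

theorem im_smul_SL (γ : SL(2, ℤ)) (z : ℍ) :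
    (γ • z).im = z.im / ‖sqrtDenom γ z‖ ^ 4 := by
  rw [ModularGroup.im_smul_eq_div_normSq, ModularGroup.denom_apply, ← sqrtDenom_sq,
    Complex.normSq_eq_norm_sq, norm_pow, ← pow_mul]

theorem conj_T_pow_mem (α : SL(2, ℤ)) (m : ℤ) :
    α * ModularGroup.T ^ (4 * m) * α⁻¹ ∈ Gamma1 4 := by
  have h1 : ModularGroup.T ^ (4 * m) ∈ Gamma 4 :=
    ModularGroup_T_pow_mem_Gamma 4 (4 * m) ⟨m, by ring⟩
  have h2 := (Gamma_normal 4).conj_mem _ h1 α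
  rw [Gamma_mem] at h2
  rw [Gamma1_mem]
  exact ⟨h2.1, h2.2.2.2, h2.2.2.1⟩

/-- As `α T^(4m) α⁻¹` lies in `Γ₁(4)`, the transform of `f` by `α` is invariant under `T^(4m)` up to
a factor of modulus one. This confines `Re z` to a bounded interval. -/
theorem norm_slash_T_pow {n : ℕ} {f : ℍ → ℂ} (hf : ∀ γ ∈ Gamma1 4, slash n f γ = f)
    (α : SL(2, ℤ)) (m : ℤ) (w : ℍ) :
    ‖(sqrtDenom α (ModularGroup.T ^ (4 * m) • w) ^ n)⁻¹ *
      f (α • ModularGroup.T ^ (4 * m) • w)‖ = ‖(sqrtDenom α w ^ n)⁻¹ * f (α • w)‖ := by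
  set t := ModularGroup.T ^ (4 * m) with ht
  set γ := α * t * α⁻¹ with hγ
  have hmem : γ ∈ Gamma1 4 := conj_T_pow_mem α m
  have e : α * t = γ * α := by simp [hγ]
  have h1 := apply_smul_of_slash_eq hmem (hf γ hmem) (α • w)
  have ht1 : ‖sqrtDenom t w‖ = 1 := by
    simp [sqrtDenom, ht, ModularGroup.coe_T_zpow]
  have h2 : ‖sqrtDenom α (t • w)‖ = ‖J γ (α • w)‖ * ‖sqrtDenom α w‖ := by
    rw [norm_J hmem, ← norm_sqrtDenom_mul, ← e, norm_sqrtDenom_mul, ht1, mul_one]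
  rw [smul_smul, e, mul_smul, h1, norm_mul, norm_inv, norm_pow, h2, norm_mul, norm_mul, norm_inv,
    norm_pow, norm_pow, mul_pow, mul_inv, mul_comm (‖J γ (α • w)‖ ^ n)⁻¹, mul_assoc,
    inv_mul_cancel_left₀ (pow_ne_zero _ (norm_ne_zero_iff.2 (J_ne_zero hmem _)))]

theorem one_le_norm_sqrtDenom (α : SL(2, ℤ)) {z : ℍ} (hz : 1 ≤ z.im) :
    1 ≤ ‖sqrtDenom α z‖ := by
  have h : 1 ≤ ‖sqrtDenom α z‖ ^ 2 := by
    rw [← norm_pow, sqrtDenom_sq]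
    rcases eq_or_ne (α 1 0) 0 with hc | hc
    · have := gcd_lower_row α
      rw [hc] at this ⊢
      simp only [Int.gcd_zero_left] at this
      simp only [Int.cast_zero, zero_mul, zero_add, Complex.norm_intCast, ← Int.cast_abs]
      rw [Int.abs_eq_natAbs, this]; simp
    · calc (1 : ℝ) ≤ |(α 1 0 : ℝ)| * z.im := by
            refine one_le_mul_of_one_le_of_one_le ?_ hz
            rw [← Int.cast_abs]; exact_mod_cast Int.one_le_abs hc
        _ = |((α 1 0 : ℂ) * z + (α 1 1 : ℂ)).im| := by
            simp [abs_mul, abs_of_pos z.im_pos]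
        _ ≤ _ := Complex.abs_im_le_norm _
  by_contra h'
  nlinarith [norm_nonneg (sqrtDenom α z)]

theorem norm_slash_le {n : ℕ} {f : ℍ → ℂ} {C : ℝ} (hC : 0 ≤ C)
    (hg : ∀ z : ℍ, ‖f z‖ ≤ C * (1 + (√z.im)⁻¹ ^ n)) (α : SL(2, ℤ)) {z : ℍ}
    (hz : 1 ≤ z.im) (hre : |z.re| ≤ 4) :
    ‖(sqrtDenom α z ^ n)⁻¹ * f (α • z)‖ ≤
      C * (1 + (5 * |(α 1 0 : ℝ)| + |(α 1 1 : ℝ)| + 1) ^ n) := by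
  -- For `|Re z| ≤ 4` and `Im z ≥ 1` one has `|z| ≤ 5 Im z`, whence `s ^ 2 ≤ B * Im z`. As `√(Im αz)
  -- = √(Im z) / s ^ 2`, the growth bound times `s ^ (-n)` leaves `(s / √(Im z)) ^ n`.
  set s := ‖sqrtDenom α z‖ with hs
  set B := 5 * |(α 1 0 : ℝ)| + |(α 1 1 : ℝ)| with hB
  have hs1 : 1 ≤ s := one_le_norm_sqrtDenom α hz
  have hB0 : 0 ≤ B := by positivity
  have hy : 0 < √z.im := Real.sqrt_pos.2 z.im_pos
  have hsq : √z.im ^ 2 = z.im := Real.sq_sqrt z.im_pos.le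
  have hs2 : s ^ 2 ≤ B * z.im := by
    rw [hs, ← norm_pow, sqrtDenom_sq]
    calc _ ≤ ‖(α 1 0 : ℂ) * z‖ + ‖(α 1 1 : ℂ)‖ := norm_add_le _ _
      _ ≤ |(α 1 0 : ℝ)| * (|z.re| + |z.im|) + |(α 1 1 : ℝ)| := by
          rw [norm_mul, Complex.norm_intCast, Complex.norm_intCast]
          gcongr
          exact Complex.norm_le_abs_re_add_abs_im _
      _ ≤ |(α 1 0 : ℝ)| * (4 * z.im + z.im) + |(α 1 1 : ℝ)| * z.im := by
          rw [abs_of_pos z.im_pos]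
          gcongr
          · linarith
          · exact le_mul_of_one_le_right (abs_nonneg _) hz
      _ = B * z.im := by rw [hB]; ring
  have hle : s / √z.im ≤ B + 1 := by
    rw [div_le_iff₀ hy]
    apply le_of_sq_le_sq _ (by positivity)
    rw [mul_pow, hsq]
    refine hs2.trans ?_
    gcongr
    nlinarith
  have him : √(α • z).im = √z.im / s ^ 2 := by
    rw [im_smul_SL, Real.sqrt_div z.im_pos.le, show ‖sqrtDenom α z‖ ^ 4 = (s ^ 2) ^ 2 by ring,
      Real.sqrt_sq (by positivity)]
  calc ‖(sqrtDenom α z ^ n)⁻¹ * f (α • z)‖ = (s ^ n)⁻¹ * ‖f (α • z)‖ := by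
        rw [norm_mul, norm_inv, norm_pow]
    _ ≤ (s ^ n)⁻¹ * (C * (1 + (√(α • z).im)⁻¹ ^ n)) := by gcongr; exact hg _
    _ = C * ((s ^ n)⁻¹ + (s / √z.im) ^ n) := by
        have : s ≠ 0 := by positivity
        rw [him, inv_div, div_pow, div_pow, ← pow_mul, mul_comm 2 n, pow_mul]
        field_simp
    _ ≤ C * (1 + (B + 1) ^ n) := by
        gcongr
        exact inv_le_one_of_one_le₀ (one_le_pow₀ hs1)

/-- A form of weight `n / 2` on `Γ₁(4)` which grows at most like `(Im z) ^ (-n/2)` towards the real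
line is bounded at all cusps. -/
theorem isBoundedAtImInfty_of_growth {n : ℕ} {f : ℍ → ℂ}
    (hf : ∀ γ ∈ Gamma1 4, slash n f γ = f) {C : ℝ} (hC : 0 ≤ C)
    (hg : ∀ z : ℍ, ‖f z‖ ≤ C * (1 + (√z.im)⁻¹ ^ n)) (α : SL(2, ℤ)) :
    IsBoundedAtImInfty fun z => (sqrtDenom α z ^ n)⁻¹ * f (α • z) := by
  rw [isBoundedAtImInfty_iff]
  refine ⟨C * (1 + (5 * |(α 1 0 : ℝ)| + |(α 1 1 : ℝ)| + 1) ^ n), 1, fun z hz => ?_⟩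
  set m := ⌊z.re / 4⌋
  set w := ModularGroup.T ^ (4 * (-m)) • z with hw
  have hz' : z = ModularGroup.T ^ (4 * m) • w := by
    rw [hw, smul_smul, ← zpow_add]; simp
  have hwre : w.re = z.re - 4 * m := by
    rw [hw, modular_T_zpow_smul, vadd_re]; push_cast; ring
  have hwim : w.im = z.im := by
    rw [hw, modular_T_zpow_smul, vadd_im]
  rw [hz', norm_slash_T_pow hf]
  refine norm_slash_le hC hg α (hwim ▸ hz) ?_
  rw [hwre, abs_le]
  have h1 := Int.floor_le (z.re / 4)
  have h2 := Int.lt_floor_add_one (z.re / 4)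
  constructor <;> linarith

end Growth

/-! ### The theta series as a form of weight `1/2`. -/

section Theta

open Complex

theorem theta_eq_jacobiTheta (z : ℍ) : theta z = jacobiTheta (2 * z) := by
  refine tsum_congr fun n => ?_
  rw [← Complex.exp_nat_mul]
  congr 1
  have : (n : ℂ) ^ 2 = ((n.natAbs ^ 2 : ℕ) : ℂ) := by
    rw [← Int.cast_natCast (R := ℂ), Nat.cast_pow, Int.natAbs_sq, Int.cast_pow]
  rw [this]; push_cast; ring

theorem theta_T_smul (z : ℍ) : theta (ModularGroup.T • z) = theta z := by
  rw [theta_eq_jacobiTheta, theta_eq_jacobiTheta, ← jacobiTheta_two_add (2 * z)]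
  congr 1
  rw [coe_smul_SL]; simp [ModularGroup.T]; ring

/-- With `τ = 2z` and `w = Sτ - 2` one has `Sw = 2 (V • z)`, so two inversions and one translation
of `jacobiTheta` suffice. The two square roots have radicands in the right half plane, with product
`4z + 1`. -/
theorem theta_V_smul (z : ℍ) : theta (V • z) = J V z * theta z := by
  have hz0 : (z : ℂ) ≠ 0 := ne_zero z
  have hV0 : (4 * z + 1 : ℂ) ≠ 0 := by simpa [V] using denom_ne_zero' V z
  let τ : ℍ := ⟨2 * z, by simp [z.im_pos]⟩
  have hτ : (τ : ℂ) = 2 * z := rfl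
  let w : ℍ := (-2 : ℝ) +ᵥ ModularGroup.S • τ
  have hS : ((ModularGroup.S • τ : ℍ) : ℂ) = -1 / (2 * z) := by
    rw [coe_smul_SL, hτ]; simp [ModularGroup.S]
  have hw : (w : ℂ) = -2 + (ModularGroup.S • τ : ℍ) := by simp [w]
  have hw' : (w : ℂ) = -(4 * z + 1) / (2 * z) := by rw [hw, hS]; field_simp; ring
  have h1 := jacobiTheta_S_smul w
  have h2 := jacobiTheta_S_smul τ
  have h3 : jacobiTheta w = jacobiTheta (ModularGroup.S • τ : ℍ) := by
    rw [← jacobiTheta_two_add, hw]; congr 1; ring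
  have h4 : ((ModularGroup.S • w : ℍ) : ℂ) = 2 * (V • z : ℍ) := by
    rw [coe_smul_SL, coe_V_smul, hw']
    have : -(4 * z + 1 : ℂ) ≠ 0 := neg_ne_zero.2 hV0
    simp [ModularGroup.S, -neg_add_rev]
    field_simp
  rw [theta_eq_jacobiTheta, theta_eq_jacobiTheta, ← h4, h1, h3, h2, ← mul_assoc, J_V,
    cpow_half_mul_of_re_pos_of_re_pos, hw', hτ]
  · congr 2
    field_simp
    simp
  · simpa using w.im_pos
  · simpa using τ.im_pos

theorem theta_smul {γ : SL(2, ℤ)} (hγ : γ ∈ Gamma1 4) (z : ℍ) :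
    theta (γ • z) = J γ z * theta z := by
  have hT (γ : SL(2, ℤ)) (hγ : γ ∈ Gamma1 4) :
      (∀ z, theta (γ • z) = J γ z * theta z) ↔
      ∀ z, theta ((γ * ModularGroup.T) • z) = J (γ * ModularGroup.T) z * theta z := by
    constructor
    · intro h z
      rw [mul_smul, h, theta_T_smul, J_mul_T hγ]
    · intro h z
      have := h (ModularGroup.T⁻¹ • z)
      rwa [mul_smul, J_mul_T hγ, ← theta_T_smul (ModularGroup.T⁻¹ • z), smul_inv_smul] at this
  have hV (γ : SL(2, ℤ)) (hγ : γ ∈ Gamma1 4) :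
      (∀ z, theta (γ • z) = J γ z * theta z) ↔
      ∀ z, theta ((γ * V) • z) = J (γ * V) z * theta z := by
    constructor
    · intro h z
      rw [mul_smul, h, theta_V_smul, J_mul_V hγ, mul_assoc]
    · intro h z
      have := h (V⁻¹ • z)
      rwa [mul_smul, J_mul_V hγ, mul_assoc, ← theta_V_smul, smul_inv_smul] at this
  -- Descent on `|c| + |d|`, in effect a proof that `T` and `V` generate `Γ₁(4)`.
  suffices ∀ N : ℕ, ∀ γ ∈ Gamma1 4, (γ 1 0).natAbs + (γ 1 1).natAbs = N →
      ∀ z, theta (γ • z) = J γ z * theta z from this _ γ hγ rfl z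
  intro N
  induction N using Nat.strong_induction_on with
  | _ N ih =>
  intro γ hγ hN
  obtain ⟨hc4, hd4⟩ := mem_Gamma1_four.1 hγ
  have row (δ : SL(2, ℤ)) (j : Fin 2) := lower_row_mul γ δ j
  have hVinv : V⁻¹ = ⟨!![1, 0; -4, 1], by simp [Matrix.det_fin_two]⟩ := by
    refine inv_eq_of_mul_eq_one_right (Subtype.ext ?_)
    change V.1 * !![1, 0; -4, 1] = 1
    simp [V, Matrix.one_fin_two]
  rcases eq_or_ne (γ 1 0) 0 with hc | hc
  · have hd : γ 1 1 = 1 := by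
      have := gcd_lower_row γ
      rw [hc] at this; simp at this; omega
    obtain ⟨b, hb⟩ := ModularGroup.exists_eq_T_zpow_of_c_eq_zero hc
    have hJ (z : ℍ) : J γ z = 1 := by simp [J, sqrtDenom, hc, hd, kroneckerSymbol_one_right]
    intro z
    have hθ (m : ℤ) (z : ℍ) : theta (ModularGroup.T ^ m • z) = theta z := by
      induction m generalizing z with
      | zero => simp
      | succ m ihm => rw [zpow_add_one, mul_smul, ihm, theta_T_smul]
      | pred m ihm =>
        rw [zpow_sub_one, mul_smul, ihm, ← theta_T_smul (ModularGroup.T⁻¹ • z), smul_inv_smul]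
    rw [hb, hJ, one_mul]; exact hθ b z
  -- Equality is impossible, since `4 ∣ c` and `d` is odd. If `|c| > 2|d|`, some `V^(±1)` shrinks
  -- `|c|`; otherwise some `T^(±1)` shrinks `|d|`. The exponent is `1` exactly when `c` and `d` have
  -- opposite signs.
  · rcases lt_or_ge (2 * (γ 1 1).natAbs) (γ 1 0).natAbs with h | h
    · by_cases hs : (0 < γ 1 0 ↔ γ 1 1 < 0)
      · rw [hV γ hγ]
        refine ih _ ?_ _ (mul_mem hγ V_mem) rfl
        have h0 := row V 0
        have h1 := row V 1
        rw [h0, h1]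
        simp [V]
        omega
      · have e : γ = γ * V⁻¹ * V := by simp
        rw [e]
        refine (hV _ (mul_mem hγ (inv_mem V_mem))).1 (ih _ ?_ _ (mul_mem hγ (inv_mem V_mem)) rfl)
        have h0 := row V⁻¹ 0
        have h1 := row V⁻¹ 1
        rw [h0, h1, hVinv]
        simp
        omega
    · by_cases hs : (0 < γ 1 0 ↔ γ 1 1 < 0)
      · rw [hT γ hγ]
        refine ih _ ?_ _ (mul_mem hγ T_mem) rfl
        have h0 := row ModularGroup.T 0
        have h1 := row ModularGroup.T 1
        rw [h0, h1]
        simp [ModularGroup.T]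
        omega
      · have e : γ = γ * ModularGroup.T⁻¹ * ModularGroup.T := by simp
        rw [e]
        refine (hT _ (mul_mem hγ (inv_mem T_mem))).1 (ih _ ?_ _ (mul_mem hγ (inv_mem T_mem)) rfl)
        have h0 := row ModularGroup.T⁻¹ 0
        have h1 := row ModularGroup.T⁻¹ 1
        rw [h0, h1, ModularGroup.coe_T_inv]
        simp
        omega

theorem norm_jacobiTheta_le_im (τ : ℍ) : ‖jacobiTheta τ‖ ≤ ‖jacobiTheta (Complex.I * τ.im)‖ := by
  have hsum : Summable fun n : ℤ => ‖cexp (Real.pi * Complex.I * (n : ℂ) ^ 2 * τ)‖ := by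
    have := (hasSum_jacobiTheta₂_term 0 τ.im_pos).summable.norm
    simpa [jacobiTheta₂_term] using this
  have hterm (n : ℤ) : cexp (Real.pi * Complex.I * (n : ℂ) ^ 2 * (Complex.I * τ.im)) =
      (‖cexp (Real.pi * Complex.I * (n : ℂ) ^ 2 * τ)‖ : ℝ) := by
    rw [Complex.norm_exp, Complex.ofReal_exp]
    congr 1
    have : (Real.pi * Complex.I * (n : ℂ) ^ 2 * τ).re = -(Real.pi * n ^ 2 * τ.im) := by
      rw [(by push_cast; ring : (Real.pi * Complex.I * n ^ 2 * τ : ℂ) = (Real.pi * n ^ 2 : ℝ) * (τ * Complex.I)),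
        re_ofReal_mul, mul_I_re]
      simp
    rw [this]; push_cast
    linear_combination (Real.pi * (n : ℂ) ^ 2 * τ.im) * Complex.I_mul_I
  calc ‖jacobiTheta τ‖ ≤ ∑' n : ℤ, ‖cexp (Real.pi * Complex.I * (n : ℂ) ^ 2 * τ)‖ :=
        norm_tsum_le_tsum_norm hsum
    _ = ‖jacobiTheta (Complex.I * τ.im)‖ := by
        rw [jacobiTheta, tsum_congr hterm, ← Complex.ofReal_tsum, Complex.norm_real,
          Real.norm_of_nonneg (tsum_nonneg fun _ => norm_nonneg _)]

theorem norm_jacobiTheta_le_of_one_le_im {τ : ℂ} (hτ : 1 ≤ τ.im) :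
    ‖jacobiTheta τ‖ ≤ 1 + 2 / (1 - Real.exp (-Real.pi)) := by
  have hpi := Real.pi_pos
  have h1 := norm_jacobiTheta_sub_one_le (show 0 < τ.im by linarith)
  have h2 : Real.exp (-Real.pi * τ.im) ≤ Real.exp (-Real.pi) := by
    apply Real.exp_le_exp.2; nlinarith
  have h3 : Real.exp (-Real.pi) < 1 := Real.exp_lt_one_iff.2 (by linarith)
  have h4 : 2 / (1 - Real.exp (-Real.pi * τ.im)) * Real.exp (-Real.pi * τ.im) ≤
      2 / (1 - Real.exp (-Real.pi)) * 1 := by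
    have : 0 < 1 - Real.exp (-Real.pi) := by linarith
    gcongr
    linarith
  calc ‖jacobiTheta τ‖ = ‖1 + (jacobiTheta τ - 1)‖ := by congr 1; ring
    _ ≤ 1 + ‖jacobiTheta τ - 1‖ := by simpa using norm_add_le (1 : ℂ) (jacobiTheta τ - 1)
    _ ≤ _ := by linarith

/-- Near the real line the modulus is at most the value on the imaginary axis at the same height,
which inversion expresses through a point of imaginary part at least `1`. -/
theorem exists_norm_theta_le : ∃ C : ℝ, 0 ≤ C ∧ ∀ z : ℍ, ‖theta z‖ ≤ C * (1 + (√z.im)⁻¹ ^ 1) := by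
  set K := 1 + 2 / (1 - Real.exp (-Real.pi)) with hK
  have hK0 : 0 ≤ K := by
    have : Real.exp (-Real.pi) < 1 := Real.exp_lt_one_iff.2 (by linarith [Real.pi_pos])
    have : 0 < 1 - Real.exp (-Real.pi) := by linarith
    positivity
  refine ⟨K, hK0, fun z => ?_⟩
  let τ : ℍ := ⟨2 * z, by simp [z.im_pos]⟩
  have hτ : (τ : ℂ) = 2 * z := rfl
  have hτim : τ.im = 2 * z.im := by rw [← coe_im, hτ]; simp
  have hy : 0 < √z.im := Real.sqrt_pos.2 z.im_pos
  rw [theta_eq_jacobiTheta, ← hτ]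
  rcases le_or_gt 1 τ.im with h | h
  · refine (norm_jacobiTheta_le_of_one_le_im h).trans ?_
    rw [← hK, pow_one, mul_add, mul_one]
    exact le_add_of_nonneg_right (by positivity)
  · refine (norm_jacobiTheta_le_im τ).trans ?_
    let w : ℍ := ⟨Complex.I * (τ.im)⁻¹, by simp [τ.im_pos]⟩
    have hw : (w : ℂ) = Complex.I * (τ.im)⁻¹ := rfl
    have hS : ((ModularGroup.S • w : ℍ) : ℂ) = Complex.I * τ.im := by
      have hne : (τ.im : ℂ) ≠ 0 := by exact_mod_cast τ.im_pos.ne'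
      rw [coe_smul_SL, hw]
      simp only [ModularGroup.S, Matrix.of_apply, Matrix.cons_val', Matrix.cons_val_zero,
        Matrix.cons_val_one, Matrix.cons_val_fin_one, Int.cast_zero, zero_mul, zero_add,
        Int.cast_neg, Int.cast_one, one_mul, add_zero, Complex.ofReal_inv]
      rw [div_eq_iff (mul_ne_zero Complex.I_ne_zero (inv_ne_zero hne)), mul_mul_mul_comm,
        Complex.I_mul_I, mul_inv_cancel₀ hne, mul_one]
    rw [← hS, jacobiTheta_S_smul, norm_mul]
    have h1 : ‖(-Complex.I * (w : ℂ)) ^ (1 / 2 : ℂ)‖ = (√τ.im)⁻¹ := by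
      rw [← Real.sqrt_inv]
      symm
      rw [Real.sqrt_eq_iff_mul_self_eq (by positivity) (norm_nonneg _), ← sq, ← norm_pow,
        cpow_half_sq, hw]
      simp [abs_of_pos τ.im_pos]
    have h2 : ‖jacobiTheta w‖ ≤ K := norm_jacobiTheta_le_of_one_le_im (by
      rw [hw]; simp [one_le_inv₀ τ.im_pos, h.le])
    have h3 : (√τ.im)⁻¹ ≤ (√z.im)⁻¹ := by
      apply inv_anti₀ hy
      apply Real.sqrt_le_sqrt
      rw [hτim]; linarith [z.im_pos]
    rw [h1]
    calc (√τ.im)⁻¹ * ‖jacobiTheta w‖ ≤ (√z.im)⁻¹ * K := by gcongr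
      _ ≤ K * (1 + (√z.im)⁻¹ ^ 1) := by rw [pow_one]; linarith

theorem mdifferentiable_theta : MDiff theta := by
  rw [UpperHalfPlane.mdifferentiable_iff]
  refine DifferentiableOn.congr (f := fun z => jacobiTheta (2 * z)) (fun z hz => ?_) fun z hz => ?_
  · refine DifferentiableAt.differentiableWithinAt ?_
    have h2 : 0 < (2 * z).im := by simpa using hz
    exact (differentiableAt_jacobiTheta h2).comp z (by fun_prop)
  · simp [theta_eq_jacobiTheta, ofComplex_apply_of_im_pos hz]

theorem theta_mem : theta ∈ M (Gamma1 4) 1 := by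
  have h (γ) (hγ : γ ∈ Gamma1 4) : slash 1 theta γ = theta :=
    slash_eq_of_apply_smul hγ fun z => by rw [pow_one, theta_smul hγ]
  obtain ⟨C, hC, hg⟩ := exists_norm_theta_le
  exact ⟨mdifferentiable_theta, h, isBoundedAtImInfty_of_growth h hC hg⟩

theorem tendsto_theta : Filter.Tendsto theta atImInfty (nhds 1) := by
  have h1 : Filter.Tendsto (fun z : ℍ => (2 * z : ℂ)) atImInfty
      (Filter.comap Complex.im Filter.atTop) := by
    rw [Filter.tendsto_comap_iff]
    have : Filter.Tendsto (fun z : ℍ => 2 * z.im) atImInfty Filter.atTop :=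
      Filter.tendsto_comap.const_mul_atTop two_pos
    refine this.congr fun z => by simp
  have h2 : Filter.Tendsto (fun τ : ℂ => jacobiTheta τ - 1)
      (Filter.comap Complex.im Filter.atTop) (nhds 0) := by
    refine isBigO_at_im_infty_jacobiTheta_sub_one.trans_tendsto ?_
    refine (Real.tendsto_exp_neg_atTop_nhds_zero.comp
      (Filter.tendsto_id.const_mul_atTop Real.pi_pos)).comp Filter.tendsto_comap |>.congr ?_
    intro τ; simp
  have h3 := (h2.comp h1).add_const 1
  simp only [zero_add] at h3
  exact h3.congr fun z => by simp [theta_eq_jacobiTheta]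

end Theta

/-! ### Dilations of the upper half plane. -/

section Dilation

/-- The map `z ↦ N z` of the upper half plane. -/
def dilate (N : ℕ) [NeZero N] (z : ℍ) : ℍ :=
  ⟨N * z, by simpa using mul_pos (Nat.cast_pos.2 (NeZero.pos N)) z.im_pos⟩

@[simp]
theorem coe_dilate (N : ℕ) [NeZero N] (z : ℍ) : (dilate N z : ℂ) = N * z := rfl

theorem dilate_im (N : ℕ) [NeZero N] (z : ℍ) : (dilate N z).im = N * z.im := by
  rw [← coe_im, coe_dilate]; simp

theorem mdifferentiable_comp_dilate {f : ℍ → ℂ} (hf : MDiff f) (N : ℕ) [NeZero N] :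
    MDiff (f ∘ dilate N) := by
  rw [UpperHalfPlane.mdifferentiable_iff] at hf ⊢
  have hN : (0 : ℝ) < N := Nat.cast_pos.2 (NeZero.pos N)
  have hmaps (z : ℂ) (hz : 0 < z.im) : 0 < ((N : ℂ) * z).im := by
    simpa using mul_pos hN hz
  refine (hf.comp (t := {z : ℂ | 0 < z.im}) (f := fun z : ℂ => (N : ℂ) * z)
    (by fun_prop) hmaps).congr fun z hz => ?_
  simp only [Function.comp_apply]
  rw [ofComplex_apply_of_im_pos hz, ofComplex_apply_of_im_pos (hmaps z hz)]
  rfl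

end Dilation

/-! ### The form `alpha4` as a combination of `E2(z)`, `E2(2z)` and `E2(4z)`. -/

section EisensteinSeries

open EisensteinSeries ArithmeticFunction

theorem eq_smul_of_mobius {γ : SL(2, ℤ)} {τ τ' : ℍ}
    (h : (τ' : ℂ) * ((γ 1 0 : ℂ) * τ + γ 1 1) = (γ 0 0 : ℂ) * τ + γ 0 1) : τ' = γ • τ := by
  ext
  rw [coe_smul_SL, eq_div_iff (denom_ne_zero' γ τ), h]

theorem E2_smul (γ : SL(2, ℤ)) (τ : ℍ) :
    E2 (γ • τ) = ((γ 1 0 : ℂ) * τ + γ 1 1) ^ 2 * E2 τ -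
      6 * Complex.I / Real.pi * γ 1 0 * ((γ 1 0 : ℂ) * τ + γ 1 1) := by
  have h := congrFun (E2_slash_action γ) τ
  rw [ModularForm.SL_slash_apply] at h
  simp only [Pi.sub_apply, Pi.smul_apply, smul_eq_mul, D2, riemannZeta_two,
    ModularGroup.denom_apply] at h
  have hd := denom_ne_zero' γ τ
  set D := (γ 1 0 : ℂ) * τ + γ 1 1
  have hpi : (Real.pi : ℂ) ≠ 0 := by exact_mod_cast Real.pi_ne_zero
  rw [zpow_neg, ← div_eq_mul_inv, div_eq_iff (zpow_ne_zero _ hd), zpow_ofNat] at h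
  rw [h]
  field_simp

/-- The cross-multiplied hypothesis suits the conjugates of `γ` by dilations, which act on `dilate N
z`. -/
theorem E2_of_mobius {a b c d : ℤ} (hdet : a * d - b * c = 1) {τ τ' : ℍ}
    (h : (τ' : ℂ) * ((c : ℂ) * τ + d) = (a : ℂ) * τ + b) :
    E2 τ' = ((c : ℂ) * τ + d) ^ 2 * E2 τ - 6 * Complex.I / Real.pi * c * ((c : ℂ) * τ + d) := by
  let γ : SL(2, ℤ) := ⟨!![a, b; c, d], by rw [Matrix.det_fin_two_of]; exact hdet⟩
  have e : τ' = γ • τ := eq_smul_of_mobius (by simpa [γ] using h)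
  rw [e, E2_smul]
  simp [γ]

theorem summable_sigma_mul_pow {r : ℂ} (hr : ‖r‖ < 1) :
    Summable fun n : ℕ => (sigma 1 n : ℂ) * r ^ n := by
  refine Summable.of_norm_bounded (summable_norm_pow_mul_geometric_of_norm_lt_one 2 hr) fun n => ?_
  rw [norm_mul, norm_mul]
  gcongr
  have := sigma_le_pow_succ 1 n
  simp only [norm_pow, Complex.norm_natCast]
  exact_mod_cast this

theorem sigma_one_two_pow_mul (k : ℕ) {m : ℕ} (hm : Odd m) :
    sigma 1 (2 ^ k * m) + sigma 1 m = 2 ^ (k + 1) * sigma 1 m := by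
  rw [isMultiplicative_sigma.map_mul_of_coprime
    ((Nat.coprime_two_left.2 hm).pow_left k), sigma_one_apply_prime_pow Nat.prime_two]
  have := Nat.geomSum_eq (le_refl 2) (k + 1)
  have h1 : 1 ≤ 2 ^ (k + 1) := Nat.one_le_two_pow
  rw [this]
  simp only [Nat.reduceSub, Nat.div_one]
  rw [← Nat.succ_mul, Nat.succ_eq_add_one, Nat.sub_add_cancel h1]

theorem sigma_one_four_mul (j : ℕ) :
    sigma 1 (4 * j) + 2 * sigma 1 j = 3 * sigma 1 (2 * j) := by
  rcases eq_or_ne j 0 with rfl | hj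
  · simp
  obtain ⟨k, m, hm, rfl⟩ := Nat.exists_eq_two_pow_mul_odd hj
  have h0 := sigma_one_two_pow_mul k hm
  have h1 := sigma_one_two_pow_mul (k + 1) hm
  have h2 := sigma_one_two_pow_mul (k + 2) hm
  rw [show 4 * (2 ^ k * m) = 2 ^ (k + 2) * m by ring, show 2 * (2 ^ k * m) = 2 ^ (k + 1) * m by ring]
  have e1 : 2 ^ (k + 1 + 1) * sigma 1 m = 2 * (2 ^ (k + 1) * sigma 1 m) := by ring
  have e2 : 2 ^ (k + 2 + 1) * sigma 1 m = 4 * (2 ^ (k + 1) * sigma 1 m) := by ring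
  omega

theorem sigma_one_two_mul_odd (j : ℕ) :
    sigma 1 (2 * (2 * j + 1)) = 3 * sigma 1 (2 * j + 1) := by
  have := sigma_one_two_pow_mul 1 (m := 2 * j + 1) ⟨j, rfl⟩
  simp only [pow_one] at this
  omega

/-- On the right, the coefficient of `r ^ n` for even `n` vanishes: the hypotheses are this
vanishing for `4 ∣ n` and for `n ≡ 2 mod 4` respectively. -/
theorem tsum_odd_of_two_mul {s : ℕ → ℂ} (h4 : ∀ j, s (2 * (2 * j)) + 2 * s j = 3 * s (2 * j))
    (hodd : ∀ j, s (2 * (2 * j + 1)) = 3 * s (2 * j + 1)) {r : ℂ}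
    (s1 : Summable fun n => s n * r ^ n) (s2 : Summable fun n => s n * (r ^ 2) ^ n)
    (s4 : Summable fun n => s n * (r ^ 4) ^ n) :
    ∑' m : ℕ, s (2 * m + 1) * r ^ (2 * m + 1) =
      ∑' n, s n * r ^ n - 3 * ∑' n, s n * (r ^ 2) ^ n + 2 * ∑' n, s n * (r ^ 4) ^ n := by
  have i2 : Function.Injective fun k : ℕ => 2 * k := fun a b h => by simpa using h
  have i2' : Function.Injective fun k : ℕ => 2 * k + 1 := fun a b h => by simpa using h
  have split {f : ℕ → ℂ} (hf : Summable f) : ∑' k, f (2 * k) + ∑' k, f (2 * k + 1) = ∑' k, f k :=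
    tsum_even_add_odd (hf.comp_injective i2) (hf.comp_injective i2')
  have t1 := split s1
  have t2 := split s2
  have sE : Summable fun k => s (2 * k) * r ^ (2 * k) := s1.comp_injective i2
  have sE2 : Summable fun k => s (2 * k) * (r ^ 2) ^ (2 * k) := s2.comp_injective i2
  have t3 := split sE
  have e1 : ∑' k, s (2 * (2 * k)) * r ^ (2 * (2 * k)) =
      3 * ∑' k, s (2 * k) * (r ^ 2) ^ (2 * k) - 2 * ∑' n, s n * (r ^ 4) ^ n := by
    rw [← tsum_mul_left, ← tsum_mul_left,
      ← Summable.tsum_sub (sE2.mul_left 3) (s4.mul_left 2)]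
    refine tsum_congr fun k => ?_
    rw [← pow_mul, ← pow_mul, show 4 * k = 2 * (2 * k) by ring]
    linear_combination r ^ (2 * (2 * k)) * h4 k
  have e2 : ∑' k, s (2 * (2 * k + 1)) * r ^ (2 * (2 * k + 1)) =
      3 * ∑' k, s (2 * k + 1) * (r ^ 2) ^ (2 * k + 1) := by
    rw [← tsum_mul_left]
    refine tsum_congr fun k => ?_
    rw [hodd, ← pow_mul, mul_assoc]
  rw [e1, e2] at t3
  rw [← t1, ← t2, ← t3]
  generalize ∑' k, s (2 * k + 1) * r ^ (2 * k + 1) = A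
  generalize ∑' k, s (2 * k + 1) * (r ^ 2) ^ (2 * k + 1) = B
  generalize ∑' k, s (2 * k) * (r ^ 2) ^ (2 * k) = C
  generalize ∑' n, s n * (r ^ 4) ^ n = D
  ring

theorem tsum_odd_sigma {r : ℂ} (hr : ‖r‖ < 1) :
    ∑' m : ℕ, (sigma 1 (2 * m + 1) : ℂ) * r ^ (2 * m + 1) =
      ∑' n : ℕ, (sigma 1 n : ℂ) * r ^ n - 3 * ∑' n : ℕ, (sigma 1 n : ℂ) * (r ^ 2) ^ n +
        2 * ∑' n : ℕ, (sigma 1 n : ℂ) * (r ^ 4) ^ n := by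
  have hpow (k : ℕ) (hk : k ≠ 0) : ‖r ^ k‖ < 1 := by
    rw [norm_pow]; exact pow_lt_one₀ (norm_nonneg _) hr hk
  refine tsum_odd_of_two_mul (s := fun n => (sigma 1 n : ℂ)) (fun j => ?_) (fun j => ?_)
    (summable_sigma_mul_pow hr) (summable_sigma_mul_pow (hpow 2 two_ne_zero))
    (summable_sigma_mul_pow (hpow 4 four_ne_zero))
  · rw [← mul_assoc]
    exact_mod_cast sigma_one_four_mul j
  · exact_mod_cast sigma_one_two_mul_odd j

theorem norm_q (z : ℍ) :
    ‖Complex.exp (2 * Real.pi * Complex.I * z)‖ = Real.exp (-(2 * Real.pi * z.im)) := by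
  rw [Complex.norm_exp]; simp

theorem norm_q_lt_one (z : ℍ) : ‖Complex.exp (2 * Real.pi * Complex.I * z)‖ < 1 := by
  rw [norm_q, Real.exp_lt_one_iff]
  have := z.im_pos
  have := Real.pi_pos
  nlinarith

theorem E2_eq_tsum_nat (z : ℍ) :
    E2 z = 1 - 24 * ∑' n : ℕ, (sigma 1 n : ℂ) * Complex.exp (2 * Real.pi * Complex.I * z) ^ n := by
  rw [E2_eq_tsum_cexp, (summable_sigma_mul_pow (norm_q_lt_one z)).tsum_eq_zero_add,
    tsum_pnat_eq_tsum_succ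
      (f := fun n => (sigma 1 n : ℂ) * Complex.exp (2 * Real.pi * Complex.I * z) ^ n)]
  simp

theorem alpha4_eq_E2 (z : ℍ) :
    alpha4 z = -(E2 z - 3 * E2 (dilate 2 z) + 2 * E2 (dilate 4 z)) / 24 := by
  rw [alpha4, tsum_odd_sigma (norm_q_lt_one z), E2_eq_tsum_nat, E2_eq_tsum_nat, E2_eq_tsum_nat]
  have h2 : Complex.exp (2 * Real.pi * Complex.I * (dilate 2 z : ℍ)) =
      Complex.exp (2 * Real.pi * Complex.I * z) ^ 2 := by
    rw [← Complex.exp_nat_mul, coe_dilate]; congr 1; ring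
  have h4 : Complex.exp (2 * Real.pi * Complex.I * (dilate 4 z : ℍ)) =
      Complex.exp (2 * Real.pi * Complex.I * z) ^ 4 := by
    rw [← Complex.exp_nat_mul, coe_dilate]; congr 1; ring
  rw [h2, h4]
  ring

/-- The correction terms of `E2` at `z`, `2z`, `4z` are proportional to `c`, `c/2`, `c/4`, and `1 -
3/2 + 2/4 = 0`. -/
theorem alpha4_smul {γ : SL(2, ℤ)} (hγ : γ 1 0 % 4 = 0) (z : ℍ) :
    alpha4 (γ • z) = ((γ 1 0 : ℂ) * z + γ 1 1) ^ 2 * alpha4 z := by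
  obtain ⟨c, hc⟩ : ∃ c, γ 1 0 = 4 * c := ⟨γ 1 0 / 4, by omega⟩
  have hdet := Matrix.det_fin_two γ.1
  rw [γ.2] at hdet
  change (1 : ℤ) = γ 0 0 * γ 1 1 - γ 0 1 * γ 1 0 at hdet
  have hD := denom_ne_zero' γ z
  rw [hc] at hdet hD
  push_cast at hD
  have h2 := E2_of_mobius (a := γ 0 0) (b := 2 * γ 0 1) (c := 2 * c) (d := γ 1 1) (by linarith)
    (τ := dilate 2 z) (τ' := dilate 2 (γ • z)) (by
      rw [coe_dilate, coe_dilate, coe_smul_SL, hc]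
      push_cast
      rw [show ((2 : ℂ) * c * (2 * z) + γ 1 1) = 4 * c * z + γ 1 1 by ring, mul_div_assoc',
        div_mul_cancel₀ _ hD]
      ring)
  have h4 := E2_of_mobius (a := γ 0 0) (b := 4 * γ 0 1) (c := c) (d := γ 1 1) (by linarith)
    (τ := dilate 4 z) (τ' := dilate 4 (γ • z)) (by
      rw [coe_dilate, coe_dilate, coe_smul_SL, hc]
      push_cast
      rw [show ((c : ℂ) * (4 * z) + γ 1 1) = 4 * c * z + γ 1 1 by ring, mul_div_assoc',
        div_mul_cancel₀ _ hD]
      ring)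
  rw [alpha4_eq_E2, alpha4_eq_E2, E2_smul, h2, h4, hc, coe_dilate, coe_dilate]
  push_cast
  ring

theorem mdifferentiable_alpha4 : MDiff alpha4 := by
  have h : alpha4 = (-1 / 24 : ℂ) • (E2 - (3 : ℂ) • (E2 ∘ dilate 2) + (2 : ℂ) • (E2 ∘ dilate 4)) := by
    ext z
    simp [alpha4_eq_E2]
    ring
  rw [h]
  exact ((E2_mdifferentiable.sub
    ((mdifferentiable_comp_dilate E2_mdifferentiable 2).const_smul (3 : ℂ))).add
    ((mdifferentiable_comp_dilate E2_mdifferentiable 4).const_smul (2 : ℂ))).const_smul _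

theorem slash_alpha4 {γ : SL(2, ℤ)} (hγ : γ ∈ Gamma1 4) : slash 4 alpha4 γ = alpha4 :=
  slash_eq_of_apply_smul hγ fun z => by
    rw [alpha4_smul (mem_Gamma1_four.1 hγ).1, ← J_sq hγ, ← pow_mul]

theorem summable_sigma_mul_exp {y : ℝ} (hy : 0 < y) :
    Summable fun n : ℕ => (sigma 1 n : ℝ) * Real.exp (-(2 * Real.pi * y)) ^ n := by
  have hr : ‖((Real.exp (-(2 * Real.pi * y)) : ℝ) : ℂ)‖ < 1 := by
    rw [Complex.norm_real, Real.norm_of_nonneg (Real.exp_pos _).le, Real.exp_lt_one_iff]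
    have := Real.pi_pos
    nlinarith
  have := summable_sigma_mul_pow hr
  exact_mod_cast this

/-- The value of `∑ σ₁(n) qⁿ` at the point `i y`. -/
noncomputable def sigmaSum (y : ℝ) : ℝ := ∑' n : ℕ, (sigma 1 n : ℝ) * Real.exp (-(2 * Real.pi * y)) ^ n

theorem sigmaSum_nonneg (y : ℝ) : 0 ≤ sigmaSum y := tsum_nonneg fun _ => by positivity

/-- The term `n = 0` vanishes, and `n y ≥ n + (y - 1)` for `n, y ≥ 1`. -/
theorem sigmaSum_le {y : ℝ} (hy : 1 ≤ y) :
    sigmaSum y ≤ Real.exp (-(2 * Real.pi * (y - 1))) * sigmaSum 1 := by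
  rw [sigmaSum, sigmaSum, ← tsum_mul_left]
  refine Summable.tsum_le_tsum (fun n => ?_) (summable_sigma_mul_exp (by linarith))
    ((summable_sigma_mul_exp one_pos).mul_left _)
  rcases eq_or_ne n 0 with rfl | hn
  · simp
  rw [mul_left_comm]
  gcongr
  rw [← Real.exp_nat_mul, ← Real.exp_nat_mul, ← Real.exp_add]
  apply Real.exp_le_exp.2
  have h1 : (1 : ℝ) ≤ n := by exact_mod_cast Nat.one_le_iff_ne_zero.2 hn
  have := Real.pi_pos
  nlinarith [mul_nonneg (mul_nonneg (sub_nonneg.2 h1) (sub_nonneg.2 hy)) this.le]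

theorem norm_E2_le (z : ℍ) : ‖E2 z‖ ≤ 1 + 24 * sigmaSum z.im := by
  rw [E2_eq_tsum_nat]
  refine (norm_sub_le _ _).trans ?_
  rw [norm_one, norm_mul]
  have h : ‖∑' n : ℕ, (sigma 1 n : ℂ) * Complex.exp (2 * Real.pi * Complex.I * z) ^ n‖ ≤
      sigmaSum z.im := by
    refine (norm_tsum_le_tsum_norm (summable_sigma_mul_pow (norm_q_lt_one z)).norm).trans_eq ?_
    refine tsum_congr fun n => ?_
    rw [norm_mul, norm_pow, norm_q, Complex.norm_natCast]
  have : ‖(24 : ℂ)‖ = 24 := by simp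
  rw [this]
  linarith

theorem norm_E2_le_of_one_le {z : ℍ} (hz : 1 ≤ z.im) : ‖E2 z‖ ≤ 1 + 24 * sigmaSum 1 := by
  refine (norm_E2_le z).trans ?_
  have h1 := sigmaSum_le hz
  have h2 : Real.exp (-(2 * Real.pi * (z.im - 1))) ≤ 1 := by
    rw [Real.exp_le_one_iff]
    have := Real.pi_pos
    nlinarith
  nlinarith [sigmaSum_nonneg 1, mul_le_mul_of_nonneg_right h2 (sigmaSum_nonneg 1)]

theorem E2_I_mul {y : ℝ} {z : ℍ} (hz : (z : ℂ) = Complex.I * y) :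
    E2 z = 1 - 24 * (sigmaSum y : ℂ) := by
  rw [E2_eq_tsum_nat, sigmaSum, Complex.ofReal_tsum]
  congr 3
  ext n
  push_cast
  congr 3
  rw [hz]
  linear_combination 2 * Real.pi * (y : ℂ) * Complex.I_mul_I

/-- All the coefficients `σ₁(n)` are nonnegative, so `E2` is controlled by its value on the
imaginary axis at the same height, to which inversion applies. The linear correction costs `6/π ≤
2`. -/
theorem exists_norm_E2_le : ∃ C : ℝ, 0 ≤ C ∧ ∀ z : ℍ, ‖E2 z‖ ≤ C * (1 + (z.im⁻¹) ^ 2) := by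
  set K := 1 + 24 * sigmaSum 1 with hK
  have hK0 : 0 ≤ K := by have := sigmaSum_nonneg 1; positivity
  refine ⟨K + 2, by positivity, fun z => ?_⟩
  have hy := z.im_pos
  rcases le_or_gt 1 z.im with h | h
  · refine (norm_E2_le_of_one_le h).trans ?_
    rw [← hK]
    nlinarith [mul_nonneg (by positivity : 0 ≤ K + 2) (sq_nonneg (z.im⁻¹))]
  · let τ : ℍ := ⟨Complex.I * z.im, by simp [hy]⟩
    let w : ℍ := ⟨Complex.I * (z.im⁻¹ : ℝ), by simp [hy]⟩
    have hne : (z.im : ℂ) ≠ 0 := by exact_mod_cast hy.ne'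
    have hw : (w : ℂ) = Complex.I * (z.im⁻¹ : ℝ) := rfl
    have hwim : w.im = z.im⁻¹ := by rw [← coe_im, hw]; simp
    have h1 : E2 τ = 1 - 24 * (sigmaSum z.im : ℂ) := E2_I_mul rfl
    have h2 := E2_of_mobius (a := 0) (b := -1) (c := 1) (d := 0) (by norm_num) (τ := w) (τ' := τ)
      (by
        rw [hw]
        change Complex.I * z.im * _ = _
        push_cast
        rw [one_mul, add_zero, mul_mul_mul_comm, Complex.I_mul_I, mul_inv_cancel₀ hne]
        ring)
    simp only [Int.cast_one, one_mul, Int.cast_zero, add_zero, mul_one] at h2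
    have h3 : ‖E2 w‖ ≤ K := norm_E2_le_of_one_le (by rw [hwim]; exact (one_le_inv₀ hy).2 h.le)
    have hwn : ‖(w : ℂ)‖ = z.im⁻¹ := by
      rw [hw, norm_mul, Complex.norm_I, one_mul, Complex.norm_real,
        Real.norm_of_nonneg (by positivity)]
    have hinv : 1 ≤ z.im⁻¹ := (one_le_inv₀ hy).2 h.le
    have h4 : ‖E2 τ‖ ≤ (z.im⁻¹) ^ 2 * K + 2 * z.im⁻¹ := by
      rw [h2]
      refine (norm_sub_le _ _).trans ?_
      rw [norm_mul, norm_pow, hwn, norm_mul, hwn]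
      gcongr
      rw [norm_div, norm_mul, Complex.norm_I, Complex.norm_real,
        Real.norm_of_nonneg Real.pi_pos.le, mul_one, div_le_iff₀ Real.pi_pos]
      have : ‖(6 : ℂ)‖ = 6 := by simp
      rw [this]
      linarith [Real.pi_gt_three]
    have h5 : 24 * sigmaSum z.im ≤ 1 + ‖E2 τ‖ := by
      have : ((24 * sigmaSum z.im : ℝ) : ℂ) = 1 - E2 τ := by rw [h1]; push_cast; ring
      calc 24 * sigmaSum z.im ≤ ‖((24 * sigmaSum z.im : ℝ) : ℂ)‖ := by
            rw [Complex.norm_real]; exact le_abs_self _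
        _ ≤ 1 + ‖E2 τ‖ := by rw [this]; simpa using norm_sub_le (1 : ℂ) (E2 τ)
    have h6 := norm_E2_le z
    nlinarith [mul_nonneg (sub_nonneg.2 hinv) (le_trans zero_le_one hinv)]

theorem exists_norm_alpha4_le :
    ∃ C : ℝ, 0 ≤ C ∧ ∀ z : ℍ, ‖alpha4 z‖ ≤ C * (1 + (√z.im)⁻¹ ^ 4) := by
  obtain ⟨C, hC, h⟩ := exists_norm_E2_le
  refine ⟨C, hC, fun z => ?_⟩
  have hs : (√z.im)⁻¹ ^ 4 = (z.im⁻¹) ^ 2 := by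
    rw [inv_pow, inv_pow, show (4 : ℕ) = 2 * 2 by norm_num, pow_mul, Real.sq_sqrt z.im_pos.le]
  have hd (N : ℕ) [NeZero N] : ‖E2 (dilate N z)‖ ≤ C * (1 + (z.im⁻¹) ^ 2) := by
    refine (h _).trans ?_
    have := z.im_pos
    gcongr
    rw [dilate_im]
    exact le_mul_of_one_le_left this.le (by exact_mod_cast NeZero.one_le)
  have h1 := h z
  have h2 := hd 2
  have h4 := hd 4
  have h0 : 0 ≤ C * (1 + (z.im⁻¹) ^ 2) := by positivity
  rw [hs, alpha4_eq_E2, norm_div, norm_neg]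
  have : ‖(24 : ℂ)‖ = 24 := by simp
  rw [this, div_le_iff₀ (by norm_num)]
  have t : ‖E2 z - 3 * E2 (dilate 2 z) + 2 * E2 (dilate 4 z)‖ ≤
      ‖E2 z‖ + 3 * ‖E2 (dilate 2 z)‖ + 2 * ‖E2 (dilate 4 z)‖ := by
    refine (norm_add_le _ _).trans ?_
    have a := norm_sub_le (E2 z) (3 * E2 (dilate 2 z))
    have e3 : ‖(3 : ℂ)‖ = 3 := by simp
    have e2 : ‖(2 : ℂ)‖ = 2 := by simp
    rw [norm_mul, e3] at a
    rw [norm_mul, e2]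
    linarith
  linarith

theorem alpha4_mem : alpha4 ∈ M (Gamma1 4) 4 := by
  obtain ⟨C, hC, hg⟩ := exists_norm_alpha4_le
  exact ⟨mdifferentiable_alpha4, fun _ => slash_alpha4,
    isBoundedAtImInfty_of_growth (fun _ => slash_alpha4) hC hg⟩

theorem norm_alpha4_le (z : ℍ) : ‖alpha4 z‖ ≤ sigmaSum z.im := by
  have s := (summable_sigma_mul_pow (norm_q_lt_one z)).norm
  have i : Function.Injective fun k : ℕ => 2 * k + 1 := fun a b h => by simpa using h
  refine (norm_tsum_le_tsum_norm (s.comp_injective i)).trans ?_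
  refine (tsum_comp_le_tsum_of_inj s (fun _ => norm_nonneg _) i).trans_eq ?_
  refine tsum_congr fun n => ?_
  rw [norm_mul, norm_pow, norm_q, Complex.norm_natCast]

theorem isZeroAtImInfty_alpha4 : IsZeroAtImInfty alpha4 := by
  have h : Filter.Tendsto (fun z : ℍ => Real.exp (-(2 * Real.pi * (z.im - 1))) * sigmaSum 1)
      atImInfty (nhds 0) := by
    have h1 : Filter.Tendsto (fun y : ℝ => 2 * Real.pi * (y - 1)) Filter.atTop Filter.atTop :=
      (Filter.tendsto_atTop_add_const_right _ (-1) Filter.tendsto_id).const_mul_atTop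
        Real.two_pi_pos
    have h2 := ((Real.tendsto_exp_neg_atTop_nhds_zero.comp h1).mul_const (sigmaSum 1)).comp
      (Filter.tendsto_comap (f := UpperHalfPlane.im))
    simpa [Function.comp_def] using! h2
  refine squeeze_zero_norm' ?_ h
  have : ∀ᶠ z : ℍ in atImInfty, 1 ≤ z.im := (Filter.eventually_ge_atTop 1).comap _
  filter_upwards [this] with z hz
  exact (norm_alpha4_le z).trans (sigmaSum_le hz)

theorem exists_alpha4_ne_zero : ∃ z : ℍ, alpha4 z ≠ 0 := by
  refine ⟨UpperHalfPlane.I, ?_⟩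
  set r := Real.exp (-(2 * Real.pi)) with hr
  have hq : Complex.exp (2 * Real.pi * Complex.I * (UpperHalfPlane.I : ℍ)) = (r : ℂ) := by
    rw [hr, Complex.ofReal_exp]
    congr 1
    rw [UpperHalfPlane.coe_I]
    push_cast
    linear_combination 2 * Real.pi * Complex.I_mul_I
  have hs := (summable_sigma_mul_exp one_pos).comp_injective
    (i := fun k : ℕ => 2 * k + 1) (fun a b h => by simpa using h)
  have hpos : 0 < ∑' m : ℕ, (sigma 1 (2 * m + 1) : ℝ) * r ^ (2 * m + 1) := by
    refine Summable.tsum_pos (by simpa [Function.comp_def, hr] using hs)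
      (fun m => by positivity) 0 ?_
    simp [hr, Real.exp_pos]
  have : alpha4 UpperHalfPlane.I =
      ((∑' m : ℕ, (sigma 1 (2 * m + 1) : ℝ) * r ^ (2 * m + 1) : ℝ) : ℂ) := by
    rw [alpha4, hq, Complex.ofReal_tsum]
    push_cast
    rfl
  rw [this]
  exact_mod_cast hpos.ne'

end EisensteinSeries

/-! ### Even index: comparison with modular forms of integral weight. -/

section ModularForms

theorem mdifferentiable_div {f g : ℍ → ℂ} (hf : MDiff f) (hg : MDiff g) (h0 : ∀ z, g z ≠ 0) :
    MDiff (fun z => f z / g z) := by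
  rw [UpperHalfPlane.mdifferentiable_iff] at hf hg ⊢
  exact hf.div hg fun z _ => h0 _

/-- A function with the transformation behaviour and the growth of a modular form of integral
weight is a modular form. -/
theorem exists_modularForm_eq {k : ℤ} {f : ℍ → ℂ} (hf : MDiff f)
    (hinv : ∀ γ ∈ Gamma1 4, ∀ z : ℍ, f (γ • z) = ((γ 1 0 : ℂ) * z + γ 1 1) ^ k * f z)
    (hb : ∀ α : SL(2, ℤ), IsBoundedAtImInfty fun z : ℍ =>
      (((α 1 0 : ℂ) * z + α 1 1) ^ k)⁻¹ * f (α • z)) :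
    ∃ g : ModularForm (Gamma1 4) k, ⇑g = f := by
  refine ⟨{ toFun := f, slash_action_eq' := ?_, holo' := hf, bdd_at_cusps' := ?_ }, rfl⟩
  · rintro _ ⟨γ, hγ, rfl⟩
    ext z
    change (f ∣[k] γ) z = f z
    rw [ModularForm.SL_slash_apply, hinv γ hγ, ModularGroup.denom_apply, zpow_neg,
      mul_right_comm, mul_inv_cancel₀ (zpow_ne_zero _ (denom_ne_zero' γ z)), one_mul]
  · intro c hc
    rw [Subgroup.IsArithmetic.isCusp_iff_isCusp_SL2Z] at hc
    rw [OnePoint.isBoundedAt_iff_forall_SL2Z hc]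
    intro α _
    refine (hb α).congr_left fun z => ?_
    rw [ModularForm.SL_slash_apply, ModularGroup.denom_apply, zpow_neg, mul_comm]

theorem ModularForm_apply_smul {k : ℤ} (g : ModularForm (Gamma1 4) k) {γ : SL(2, ℤ)}
    (hγ : γ ∈ Gamma1 4) (z : ℍ) : g (γ • z) = ((γ 1 0 : ℂ) * z + γ 1 1) ^ k * g z := by
  have h : (⇑g ∣[k] γ) z = g z :=
    congrFun (g.slash_action_eq' _ (Subgroup.mem_map_of_mem _ hγ)) z
  rw [ModularForm.SL_slash_apply, ModularGroup.denom_apply, zpow_neg, ← div_eq_mul_inv,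
    div_eq_iff (zpow_ne_zero _ (denom_ne_zero' γ z))] at h
  rw [h, mul_comm]

theorem ModularForm_isBoundedAtImInfty {k : ℤ} (g : ModularForm (Gamma1 4) k) (α : SL(2, ℤ)) :
    IsBoundedAtImInfty fun z : ℍ => (((α 1 0 : ℂ) * z + α 1 1) ^ k)⁻¹ * g (α • z) := by
  have hc : IsCusp (Matrix.SpecialLinearGroup.mapGL ℝ α • OnePoint.infty) 𝒮ℒ :=
    isCusp_SL2Z_iff'.2 ⟨α, rfl⟩
  have h := g.bdd_at_cusps' ((Subgroup.IsArithmetic.isCusp_iff_isCusp_SL2Z _).2 hc)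
  rw [OnePoint.isBoundedAt_iff_forall_SL2Z hc] at h
  refine (h α rfl).congr_left fun z => ?_
  rw [ModularForm.SL_slash_apply, ModularGroup.denom_apply, zpow_neg, mul_comm]
  rfl

theorem mem_M_two_mul_iff (k : ℕ) (f : ℍ → ℂ) :
    f ∈ M (Gamma1 4) (2 * k) ↔ ∃ g : ModularForm (Gamma1 4) (k : ℤ), ⇑g = f := by
  constructor
  · rintro ⟨h1, h2, h3⟩
    refine exists_modularForm_eq h1 (fun γ hγ z => ?_) fun α => ?_
    · rw [apply_smul_of_slash_eq hγ (h2 γ hγ), pow_mul, J_sq hγ, zpow_natCast]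
    · refine (h3 α).congr_left fun z => ?_
      rw [pow_mul, sqrtDenom_sq, zpow_natCast]
  · rintro ⟨g, rfl⟩
    refine ⟨g.holo', fun γ hγ => slash_eq_of_apply_smul hγ fun z => ?_, fun α => ?_⟩
    · rw [ModularForm_apply_smul g hγ, pow_mul, J_sq hγ, zpow_natCast]
    · refine (ModularForm_isBoundedAtImInfty g α).congr_left fun z => ?_
      rw [pow_mul, sqrtDenom_sq, zpow_natCast]

end ModularForms

/-! ### The eta quotient and its orders at the three cusps. -/

section Discriminant

open ModularForm (discriminant)

theorem discriminant_of_mobius {a b c d : ℤ} (hdet : a * d - b * c = 1) {τ τ' : ℍ}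
    (h : (τ' : ℂ) * ((c : ℂ) * τ + d) = (a : ℂ) * τ + b) :
    discriminant τ' = ((c : ℂ) * τ + d) ^ 12 * discriminant τ := by
  let γ : SL(2, ℤ) := ⟨!![a, b; c, d], by rw [Matrix.det_fin_two_of]; exact hdet⟩
  have e : τ' = γ • τ := eq_smul_of_mobius (by simpa [γ] using h)
  have hs : (discriminant ∣[(12 : ℤ)] γ) τ = discriminant τ :=
    congrFun (CuspForm.discriminant.slash_action_eq' _ ⟨γ, rfl⟩) τ
  rw [ModularForm.SL_slash_apply, ModularGroup.denom_apply, zpow_neg, ← div_eq_mul_inv,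
    div_eq_iff (zpow_ne_zero _ (denom_ne_zero' γ τ))] at hs
  rw [e, hs, mul_comm]
  simp only [γ]
  norm_cast

theorem eventually_discriminant_bounds : ∃ A : ℝ, ∀ z : ℍ, A ≤ z.im →
    1 / 2 * Real.exp (-(2 * Real.pi * z.im)) ≤ ‖discriminant z‖ ∧
      ‖discriminant z‖ ≤ 2 * Real.exp (-(2 * Real.pi * z.im)) := by
  have h := ModularForm.tendsto_atImInfty_tprod_one_sub_eta_q_pow.eventually
    (Metric.ball_mem_nhds 1 (by norm_num : (0 : ℝ) < 1 / 2))
  obtain ⟨A, hA⟩ := (atImInfty_mem _).1 h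
  refine ⟨A, fun z hz => ?_⟩
  have hz' := hA z hz
  simp only [Set.mem_ofPred_eq, dist_eq_norm] at hz'
  rw [ModularForm.discriminant_eq_q_prod, norm_mul]
  have hq : ‖Function.Periodic.qParam 1 (z : ℂ)‖ = Real.exp (-(2 * Real.pi * z.im)) := by
    rw [← norm_q]; simp [Function.Periodic.qParam]
  rw [hq]
  set P := ∏' n, (1 - ModularForm.eta_q n z) ^ 24
  have h1 : ‖P‖ ≤ 1 + ‖P - 1‖ := by
    calc ‖P‖ = ‖1 + (P - 1)‖ := by congr 1; ring
      _ ≤ _ := by simpa using norm_add_le (1 : ℂ) (P - 1)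
  have h2 : 1 ≤ ‖P‖ + ‖P - 1‖ := by
    calc (1 : ℝ) = ‖P - (P - 1)‖ := by simp
      _ ≤ _ := norm_sub_le _ _
  have h3 := Real.exp_pos (-(2 * Real.pi * z.im))
  constructor <;> nlinarith

/-- The eta quotient `η(4z)^48 / η(2z)^24`. -/
noncomputable def etaQuotient (z : ℍ) : ℂ :=
  discriminant (dilate 4 z) ^ 2 / discriminant (dilate 2 z)

theorem etaQuotient_ne_zero (z : ℍ) : etaQuotient z ≠ 0 :=
  div_ne_zero (pow_ne_zero _ (ModularForm.discriminant_ne_zero _))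
    (ModularForm.discriminant_ne_zero _)

theorem mdifferentiable_etaQuotient : MDiff etaQuotient :=
  mdifferentiable_div
    ((mdifferentiable_comp_dilate CuspForm.discriminant.holo' 4).pow 2)
    (mdifferentiable_comp_dilate CuspForm.discriminant.holo' 2)
    fun _ => ModularForm.discriminant_ne_zero _

theorem det_eq (γ : SL(2, ℤ)) : γ 0 0 * γ 1 1 - γ 0 1 * γ 1 0 = 1 := by
  have hdet := Matrix.det_fin_two γ.1
  rw [γ.2] at hdet
  exact hdet.symm

theorem smul_mul_denom (γ : SL(2, ℤ)) (z : ℍ) :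
    ((γ • z : ℍ) : ℂ) * ((γ 1 0 : ℂ) * z + γ 1 1) = (γ 0 0 : ℂ) * z + γ 0 1 := by
  rw [coe_smul_SL, div_mul_cancel₀ _ (denom_ne_zero' γ z)]

theorem etaQuotient_smul {γ : SL(2, ℤ)} (hγ : γ 1 0 % 4 = 0) (z : ℍ) :
    etaQuotient (γ • z) = ((γ 1 0 : ℂ) * z + γ 1 1) ^ 12 * etaQuotient z := by
  obtain ⟨c, hc⟩ : ∃ c, γ 1 0 = 4 * c := ⟨γ 1 0 / 4, by omega⟩
  have hdet := det_eq γ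
  have hD := denom_ne_zero' γ z
  have hs := smul_mul_denom γ z
  rw [hc] at hdet hD hs ⊢
  push_cast at hD hs ⊢
  have h2 := discriminant_of_mobius (a := γ 0 0) (b := 2 * γ 0 1) (c := 2 * c) (d := γ 1 1)
    (by linarith) (τ := dilate 2 z) (τ' := dilate 2 (γ • z)) (by
      rw [coe_dilate, coe_dilate]; push_cast; linear_combination 2 * hs)
  have h4 := discriminant_of_mobius (a := γ 0 0) (b := 4 * γ 0 1) (c := c) (d := γ 1 1)
    (by linarith) (τ := dilate 4 z) (τ' := dilate 4 (γ • z)) (by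
      rw [coe_dilate, coe_dilate]; push_cast; linear_combination 4 * hs)
  rw [etaQuotient, etaQuotient, h2, h4, coe_dilate, coe_dilate]
  have := ModularForm.discriminant_ne_zero (dilate 2 z)
  push_cast
  rw [show (c : ℂ) * (4 * z) + γ 1 1 = 4 * c * z + γ 1 1 by ring,
    show 2 * (c : ℂ) * (2 * z) + γ 1 1 = 4 * c * z + γ 1 1 by ring]
  field_simp

/-- The order at `∞` is `2 * 4 - 2 = 6`; the constant is `(1/2)² / 2`. -/
theorem norm_etaQuotient_ge : ∀ᶠ z : ℍ in atImInfty,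
    1 / 8 * Real.exp (-(2 * Real.pi * z.im)) ^ 6 ≤ ‖etaQuotient z‖ := by
  obtain ⟨A, hA⟩ := eventually_discriminant_bounds
  refine (atImInfty_mem _).2 ⟨A, fun z hz => ?_⟩
  have hle (N : ℕ) [NeZero N] : A ≤ (dilate N z).im := by
    rw [dilate_im]
    exact hz.trans (le_mul_of_one_le_left z.im_pos.le (by exact_mod_cast NeZero.one_le))
  have h4 := (hA _ (hle 4)).1
  have h2 := (hA _ (hle 2)).2
  have e4 : Real.exp (-(2 * Real.pi * (dilate 4 z).im)) = Real.exp (-(2 * Real.pi * z.im)) ^ 4 := by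
    rw [dilate_im, ← Real.exp_nat_mul]; congr 1; push_cast; ring
  have e2 : Real.exp (-(2 * Real.pi * (dilate 2 z).im)) = Real.exp (-(2 * Real.pi * z.im)) ^ 2 := by
    rw [dilate_im, ← Real.exp_nat_mul]; congr 1; push_cast; ring
  rw [e4] at h4
  rw [e2] at h2
  have hr := Real.exp_pos (-(2 * Real.pi * z.im))
  set r := Real.exp (-(2 * Real.pi * z.im))
  have hpos : 0 < ‖discriminant (dilate 2 z)‖ :=
    norm_pos_iff.2 (ModularForm.discriminant_ne_zero _)
  simp only [Set.mem_ofPred_eq]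
  rw [etaQuotient, norm_div, norm_pow, le_div_iff₀ hpos]
  calc 1 / 8 * r ^ 6 * ‖discriminant (dilate 2 z)‖ ≤ 1 / 8 * r ^ 6 * (2 * r ^ 2) := by gcongr
    _ = (1 / 2 * r ^ 4) ^ 2 := by ring
    _ ≤ _ := by gcongr

/-- The translate of a rescaling of the upper half plane. -/
noncomputable def affineMap (N : ℕ) [NeZero N] (m : ℝ) (z : ℍ) : ℍ :=
  ⟨(z + m) / N, by
    rw [Complex.div_natCast_im]
    simpa using div_pos z.im_pos (Nat.cast_pos.2 (NeZero.pos N))⟩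

theorem coe_affineMap (N : ℕ) [NeZero N] (m : ℝ) (z : ℍ) :
    (affineMap N m z : ℂ) = (z + m) / N := rfl

theorem affineMap_im (N : ℕ) [NeZero N] (m : ℝ) (z : ℍ) :
    (affineMap N m z).im = z.im / N := by
  rw [← coe_im, coe_affineMap, Complex.div_natCast_im]; simp

/-- Since `c` is odd, `d ≡ c m mod 4` for some `m`, and the same `m` works modulo `2`. Then `4 (α •
z)` and `2 (α • z)` are `SL₂(ℤ)`-translates of `(z + m) / 4` and `(z + m) / 2`. The quotient has
order `2/4 - 1/2 = 0`. -/
theorem etaQuotient_smul_of_odd {α : SL(2, ℤ)} (hα : α 1 0 % 2 = 1) :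
    ∃ m : ℝ, ∃ K : ℂ, K ≠ 0 ∧ ∀ z : ℍ, etaQuotient (α • z) =
      ((α 1 0 : ℂ) * z + α 1 1) ^ 12 * K * (discriminant (affineMap 4 m z) ^ 2 / discriminant (affineMap 2 m z)) := by
  obtain ⟨m, d', hd⟩ : ∃ m d' : ℤ, α 1 1 = α 1 0 * m + 4 * d' := by
    have h := Int.emod_add_mul_ediv (α 1 0) 4
    have : α 1 0 % 4 = 1 ∨ α 1 0 % 4 = 3 := by omega
    rcases this with h1 | h1
    · exact ⟨α 1 1, -(α 1 0 / 4) * α 1 1, by linear_combination α 1 1 * h - α 1 1 * h1⟩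
    · refine ⟨-α 1 1, (α 1 0 / 4 + 1) * α 1 1, by linear_combination -α 1 1 * h + α 1 1 * h1⟩
  refine ⟨m, ((2 : ℂ) ^ 36)⁻¹, inv_ne_zero (pow_ne_zero _ two_ne_zero), fun z => ?_⟩
  have hdet := det_eq α
  have hs := smul_mul_denom α z
  have hd' : (α 1 1 : ℂ) = α 1 0 * m + 4 * d' := by exact_mod_cast hd
  have h4 := discriminant_of_mobius (a := 4 * α 0 0) (b := α 0 1 - α 0 0 * m) (c := α 1 0) (d := d')
    (by rw [hd] at hdet; linarith) (τ := affineMap 4 m z) (τ' := dilate 4 (α • z)) (by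
      rw [coe_dilate, coe_affineMap]; push_cast
      rw [hd'] at hs
      linear_combination hs)
  have h2 := discriminant_of_mobius (a := 2 * α 0 0) (b := α 0 1 - α 0 0 * m) (c := α 1 0)
    (d := 2 * d') (by rw [hd] at hdet; linarith) (τ := affineMap 2 m z) (τ' := dilate 2 (α • z)) (by
      rw [coe_dilate, coe_affineMap]; push_cast
      rw [hd'] at hs
      linear_combination hs)
  have e4 : (α 1 0 : ℂ) * (affineMap 4 m z : ℍ) + d' = ((α 1 0 : ℂ) * z + α 1 1) / 4 := by
    rw [coe_affineMap, hd']; push_cast; ring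
  have e2 : (α 1 0 : ℂ) * (affineMap 2 m z : ℍ) + (2 * d' : ℤ) =
      ((α 1 0 : ℂ) * z + α 1 1) / 2 := by
    rw [coe_affineMap, hd']; push_cast; ring
  have hD := denom_ne_zero' α z
  have := ModularForm.discriminant_ne_zero (affineMap 2 m z)
  rw [etaQuotient, h4, h2, e4, e2]
  generalize (α 1 0 : ℂ) * z + α 1 1 = D at *
  field_simp
  norm_num [mul_comm]

/-- Here `4 (α • z)` and `2 (α • z)` are `SL₂(ℤ)`-translates of `z + 1/2` and `2z`, so the order is
`2 - 2 = 0`. -/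
theorem etaQuotient_smul_of_two_mod_four {α : SL(2, ℤ)} (hα : α 1 0 % 4 = 2) :
    ∃ K : ℂ, K ≠ 0 ∧ ∀ z : ℍ, etaQuotient (α • z) = ((α 1 0 : ℂ) * z + α 1 1) ^ 12 * K *
      (discriminant (affineMap 1 (1 / 2) z) ^ 2 / discriminant (dilate 2 z)) := by
  refine ⟨((2 : ℂ) ^ 24)⁻¹, inv_ne_zero (pow_ne_zero _ two_ne_zero), fun z => ?_⟩
  obtain ⟨c, hc⟩ : ∃ c, α 1 0 = 2 * c := ⟨α 1 0 / 2, by omega⟩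
  have hdet := det_eq α
  have hodd : α 1 1 % 2 = 1 := by
    have h := gcd_lower_row α
    rw [hc] at h
    by_contra h'
    have h1 : (2 : ℤ) ∣ ((2 * c).gcd (α 1 1) : ℤ) :=
      Int.dvd_coe_gcd (Dvd.intro _ rfl) (by omega)
    rw [h] at h1
    omega
  obtain ⟨d', hd⟩ : ∃ d', α 1 1 = 2 * d' + c := ⟨(α 1 1 - c) / 2, by omega⟩
  have hs := smul_mul_denom α z
  have hD := denom_ne_zero' α z
  have hc' : (α 1 0 : ℂ) = 2 * c := by exact_mod_cast hc
  have hd' : (α 1 1 : ℂ) = 2 * d' + c := by exact_mod_cast hd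
  have h4 := discriminant_of_mobius (a := 2 * α 0 0) (b := 2 * α 0 1 - α 0 0) (c := c) (d := d')
    (by rw [hd, hc] at hdet; linarith) (τ := affineMap 1 (1 / 2) z) (τ' := dilate 4 (α • z)) (by
      rw [coe_dilate, coe_affineMap]; push_cast
      rw [hd', hc'] at hs
      linear_combination 2 * hs)
  have h2 := discriminant_of_mobius (a := α 0 0) (b := 2 * α 0 1) (c := c)
    (d := α 1 1) (by rw [hc] at hdet; linarith) (τ := dilate 2 z) (τ' := dilate 2 (α • z)) (by
      rw [coe_dilate, coe_dilate]; push_cast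
      rw [hc'] at hs
      linear_combination 2 * hs)
  have e4 : (c : ℂ) * (affineMap 1 (1 / 2) z : ℍ) + d' = ((α 1 0 : ℂ) * z + α 1 1) / 2 := by
    rw [coe_affineMap, hd', hc']; push_cast; ring
  have e2 : (c : ℂ) * (dilate 2 z : ℍ) + (α 1 1 : ℤ) = ((α 1 0 : ℂ) * z + α 1 1) := by
    rw [coe_dilate, hc']; push_cast; ring
  have := ModularForm.discriminant_ne_zero (dilate 2 z)
  rw [etaQuotient, h4, h2, e4, e2]
  generalize (α 1 0 : ℂ) * z + α 1 1 = D at *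
  field_simp

/-- The eta quotient does not vanish at the cusps that are not equivalent to `∞`. -/
theorem norm_slash_etaQuotient_ge {α : SL(2, ℤ)} (hα : α 1 0 % 4 ≠ 0) :
    ∃ ε : ℝ, 0 < ε ∧ ∀ᶠ z : ℍ in atImInfty,
      ε ≤ ‖(((α 1 0 : ℂ) * z + α 1 1) ^ 12)⁻¹ * etaQuotient (α • z)‖ := by
  obtain ⟨A, hA⟩ := eventually_discriminant_bounds
  have key {r x y : ℝ} (hr : 0 < r) (hx : 1 / 2 * r ≤ x) (hy : y ≤ 2 * r ^ 2) (hy0 : 0 < y) :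
      1 / 8 ≤ x ^ 2 / y := by
    rw [le_div_iff₀ hy0]
    nlinarith [pow_le_pow_left₀ (by positivity) hx 2]
  rcases Nat.lt_or_ge 0 (α 1 0 % 2).natAbs with h | h
  · obtain ⟨m, K, hK, hm⟩ := etaQuotient_smul_of_odd (α := α) (by omega)
    refine ⟨‖K‖ * (1 / 8), by positivity,
      (atImInfty_mem _).2 ⟨4 * |A|, fun z hz => ?_⟩⟩
    simp only [Set.mem_ofPred_eq]
    have hle := le_abs_self A
    have hle' := abs_nonneg A
    have i4 : (affineMap 4 m z).im = z.im / 4 := by rw [affineMap_im]; norm_num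
    have i2 : (affineMap 2 m z).im = z.im / 2 := by rw [affineMap_im]; norm_num
    have h4 := (hA (affineMap 4 m z) (by rw [i4]; linarith)).1
    have h2 := (hA (affineMap 2 m z) (by rw [i2]; linarith)).2
    rw [hm, mul_assoc, inv_mul_cancel_left₀ (pow_ne_zero _ (denom_ne_zero' α z)), norm_mul,
      norm_div, norm_pow]
    refine mul_le_mul_of_nonneg_left ?_ (norm_nonneg K)
    refine key (Real.exp_pos _) h4 (h2.trans_eq ?_)
      (norm_pos_iff.2 (ModularForm.discriminant_ne_zero _))
    rw [i4, i2, ← Real.exp_nat_mul]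
    congr 2
    push_cast; ring
  · obtain ⟨K, hK, hm⟩ := etaQuotient_smul_of_two_mod_four (α := α) (by omega)
    refine ⟨‖K‖ * (1 / 8), by positivity,
      (atImInfty_mem _).2 ⟨4 * |A|, fun z hz => ?_⟩⟩
    simp only [Set.mem_ofPred_eq]
    have hle := le_abs_self A
    have hle' := abs_nonneg A
    have i4 : (affineMap 1 (1 / 2) z).im = z.im := by rw [affineMap_im]; norm_num
    have i2 : (dilate 2 z).im = 2 * z.im := by rw [dilate_im]; norm_num
    have h4 := (hA (affineMap 1 (1 / 2) z) (by rw [i4]; linarith)).1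
    have h2 := (hA (dilate 2 z) (by rw [i2]; linarith)).2
    rw [hm, mul_assoc,
      inv_mul_cancel_left₀ (pow_ne_zero _ (denom_ne_zero' α z)), norm_mul,
      norm_div, norm_pow]
    refine mul_le_mul_of_nonneg_left ?_ (norm_nonneg K)
    refine key (Real.exp_pos _) h4 (h2.trans_eq ?_)
      (norm_pos_iff.2 (ModularForm.discriminant_ne_zero _))
    rw [i4, i2, ← Real.exp_nat_mul]
    congr 2
    push_cast; ring

end Discriminant

/-! ### Division by `alpha4`. -/

section Division

theorem apply_T_smul {n : ℕ} {f : ℍ → ℂ} (hf : f ∈ M (Gamma1 4) n) (z : ℍ) :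
    f (ModularGroup.T • z) = f z := by
  have hJ : J ModularGroup.T z = 1 := by
    simp [J, sqrtDenom, ModularGroup.T, kroneckerSymbol_one_right]
  rw [apply_smul_of_slash_eq T_mem (hf.2.1 _ T_mem), hJ, one_pow, one_mul]

theorem periodic_comp_ofComplex {n : ℕ} {f : ℍ → ℂ} (hf : f ∈ M (Gamma1 4) n) :
    Function.Periodic (f ∘ ofComplex) ((1 : ℝ) : ℂ) := by
  intro w
  by_cases hw : 0 < w.im
  · have hw' : 0 < (w + ((1 : ℝ) : ℂ)).im := by simpa using hw
    simp only [Function.comp_apply]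
    rw [ofComplex_apply_of_im_pos hw, ofComplex_apply_of_im_pos hw',
      ← apply_T_smul hf ⟨w, hw⟩]
    congr 1
    ext
    rw [coe_smul_SL]
    simp [ModularGroup.T]
  · have hw' : (w + ((1 : ℝ) : ℂ)).im ≤ 0 := by simpa using hw
    simp only [Function.comp_apply]
    rw [ofComplex_apply_of_im_nonpos (not_lt.1 hw), ofComplex_apply_of_im_nonpos hw']

theorem isBoundedAtImInfty_of_mem {n : ℕ} {f : ℍ → ℂ} (hf : f ∈ M (Gamma1 4) n) :
    IsBoundedAtImInfty f := by
  refine (hf.2.2 1).congr_left fun z => ?_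
  simp [sqrtDenom]

/-- Period `1` makes the `q`-expansion run over integral powers, so vanishing at `∞` means order at
least one, which is the order of `alpha4`. -/
theorem exists_norm_le_exp_of_isZero {n : ℕ} {f : ℍ → ℂ} (hf : f ∈ M (Gamma1 4) n)
    (h0 : IsZeroAtImInfty f) :
    ∃ C : ℝ, 0 < C ∧ ∀ᶠ z in atImInfty, ‖f z‖ ≤ C * Real.exp (-(2 * Real.pi * z.im)) := by
  obtain ⟨C, hC, h⟩ := (h0.exp_decay_atImInfty one_pos (periodic_comp_ofComplex hf) hf.1
    (isBoundedAtImInfty_of_mem hf)).exists_pos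
  refine ⟨C, hC, h.bound.mono fun z hz => ?_⟩
  rw [Real.norm_of_nonneg (Real.exp_pos _).le] at hz
  convert hz using 3
  ring

theorem exists_tendsto_atImInfty {n : ℕ} {f : ℍ → ℂ} (hf : f ∈ M (Gamma1 4) n) :
    ∃ a, Filter.Tendsto f atImInfty (nhds a) := by
  refine ⟨valueAtInfty f, ?_⟩
  have h := exp_decay_sub_atImInfty one_pos (periodic_comp_ofComplex hf) hf.1
    (isBoundedAtImInfty_of_mem hf)
  have h1 : Filter.Tendsto (fun z : ℍ => Real.exp (-2 * Real.pi * z.im / 1)) atImInfty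
      (nhds 0) := by
    have := (Real.tendsto_exp_neg_atTop_nhds_zero.comp
      (Filter.tendsto_id.const_mul_atTop Real.two_pi_pos)).comp
      (Filter.tendsto_comap (f := UpperHalfPlane.im) (x := Filter.atTop))
    refine this.congr fun z => ?_
    simp
  have h2 := (h.trans_tendsto h1).add_const (valueAtInfty f)
  simpa using h2

/-- Either `γ` or `-γ` lies in `Γ₁(4)`, and the sign is invisible to the modulus. -/
theorem norm_slash_of_four_dvd {n : ℕ} {f : ℍ → ℂ} (hf : f ∈ M (Gamma1 4) n) {γ : SL(2, ℤ)}
    (hγ : γ 1 0 % 4 = 0) (z : ℍ) :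
    ‖(sqrtDenom γ z ^ n)⁻¹ * f (γ • z)‖ = ‖f z‖ := by
  have key {δ : SL(2, ℤ)} (hδ : δ ∈ Gamma1 4) :
      ‖(sqrtDenom δ z ^ n)⁻¹ * f (δ • z)‖ = ‖f z‖ := by
    rw [apply_smul_of_slash_eq hδ (hf.2.1 _ hδ), norm_mul, norm_mul, norm_inv, norm_pow, norm_pow,
      norm_J hδ, inv_mul_cancel_left₀ (pow_ne_zero _ (norm_ne_zero_iff.2 (sqrtDenom_ne_zero δ z)))]
  have hodd : γ 1 1 % 4 = 1 ∨ γ 1 1 % 4 = 3 := by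
    have hdet := det_eq γ
    obtain ⟨c, hc⟩ : ∃ c, γ 1 0 = 4 * c := ⟨γ 1 0 / 4, by omega⟩
    by_contra h
    obtain ⟨d, hd⟩ : ∃ d, γ 1 1 = 2 * d := ⟨γ 1 1 / 2, by omega⟩
    rw [hc, hd] at hdet
    have : 2 * (γ 0 0 * d - γ 0 1 * (2 * c)) = 1 := by linarith
    omega
  rcases hodd with h | h
  · exact key (mem_Gamma1_four.2 ⟨hγ, h⟩)
  · have h0 : (-γ) 1 0 = -γ 1 0 := by simp
    have h1 : (-γ) 1 1 = -γ 1 1 := by simp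
    have hmem : -γ ∈ Gamma1 4 := mem_Gamma1_four.2 ⟨by rw [h0]; omega, by rw [h1]; omega⟩
    have hn : ‖sqrtDenom (-γ) z‖ = ‖sqrtDenom γ z‖ := by
      have : ‖sqrtDenom (-γ) z‖ ^ 2 = ‖sqrtDenom γ z‖ ^ 2 := by
        rw [← norm_pow, ← norm_pow, sqrtDenom_sq, sqrtDenom_sq, h0, h1, ← norm_neg]
        congr 1
        push_cast; ring
      exact (sq_eq_sq₀ (norm_nonneg _) (norm_nonneg _)).1 this
    rw [← key hmem, ModularGroup.SL_neg_smul, norm_mul, norm_mul, norm_inv, norm_inv, norm_pow,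
      norm_pow, hn]

/-- The sixth power of `α₄` is a nonzero multiple of the eta quotient. -/
theorem exists_alpha4_pow_six_eq : ∃ c : ℂ, c ≠ 0 ∧ ∀ z, alpha4 z ^ 6 = c * etaQuotient z := by
  set u : ℍ → ℂ := fun z => alpha4 z ^ 6 / etaQuotient z with hu
  have hinv {γ : SL(2, ℤ)} (hγ : γ 1 0 % 4 = 0) (z : ℍ) : u (γ • z) = u z := by
    simp only [hu]
    rw [alpha4_smul hγ, etaQuotient_smul hγ, mul_pow, ← pow_mul,
      mul_div_mul_left _ _ (pow_ne_zero _ (denom_ne_zero' γ z))]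
  have hbdd : IsBoundedAtImInfty u := by
    obtain ⟨C, hC, h⟩ := exists_norm_le_exp_of_isZero alpha4_mem isZeroAtImInfty_alpha4
    refine Asymptotics.IsBigO.of_bound (8 * C ^ 6) ?_
    filter_upwards [h, norm_etaQuotient_ge] with z h1 h2
    have hr := Real.exp_pos (-(2 * Real.pi * z.im))
    set r := Real.exp (-(2 * Real.pi * z.im))
    simp only [hu, Pi.one_apply, norm_one, mul_one]
    rw [norm_div, norm_pow, div_le_iff₀ (norm_pos_iff.2 (etaQuotient_ne_zero z))]
    calc ‖alpha4 z‖ ^ 6 ≤ (C * r) ^ 6 := by gcongr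
      _ = 8 * C ^ 6 * (1 / 8 * r ^ 6) := by ring
      _ ≤ _ := by gcongr
  obtain ⟨g, hg⟩ := exists_modularForm_eq (k := 0) (f := u)
    (mdifferentiable_div (mdifferentiable_alpha4.pow 6) mdifferentiable_etaQuotient
      etaQuotient_ne_zero)
    (fun γ hγ z => by rw [hinv (mem_Gamma1_four.1 hγ).1, zpow_zero, one_mul])
    (fun α => by
      simp only [zpow_zero, inv_one, one_mul]
      -- At cusps equivalent to `∞`, invariance of `u` reduces to `hbdd`. Elsewhere the denominator
      -- stays away from zero and the numerator is bounded.
      by_cases hα : α 1 0 % 4 = 0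
      · exact hbdd.congr_left fun z => (hinv hα z).symm
      · obtain ⟨ε, hε, h1⟩ := norm_slash_etaQuotient_ge hα
        obtain ⟨K, hK, h2⟩ := (alpha4_mem.2.2 α).exists_pos
        refine Asymptotics.IsBigO.of_bound (K ^ 6 / ε) ?_
        filter_upwards [h1, h2.bound] with z h3 h4
        simp only [Pi.one_apply, norm_one, mul_one] at h4 ⊢
        have hD := denom_ne_zero' α z
        rw [show sqrtDenom α z ^ 4 = (sqrtDenom α z ^ 2) ^ 2 by ring, sqrtDenom_sq] at h4
        have e : u (α • z) =
            (((((α 1 0 : ℂ) * z + α 1 1) ^ 2)⁻¹ * alpha4 (α • z)) ^ 6) /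
              ((((α 1 0 : ℂ) * z + α 1 1) ^ 12)⁻¹ * etaQuotient (α • z)) := by
          simp only [hu]
          rw [mul_pow, inv_pow, ← pow_mul,
            mul_div_mul_left _ _ (inv_ne_zero (pow_ne_zero _ hD))]
        rw [e, norm_div, norm_pow]
        gcongr)
  obtain ⟨c, hc⟩ := ModularForm.eq_const_of_weight_zero g
  have h (z : ℍ) : alpha4 z ^ 6 = c * etaQuotient z := by
    have : u z = c := by rw [← hg, hc]; rfl
    rw [← this, hu, div_mul_cancel₀ _ (etaQuotient_ne_zero z)]
  refine ⟨c, ?_, h⟩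
  rintro rfl
  obtain ⟨z, hz⟩ := exists_alpha4_ne_zero
  have := h z
  rw [zero_mul] at this
  exact hz (pow_eq_zero_iff (by norm_num) |>.1 this)

theorem alpha4_ne_zero (z : ℍ) : alpha4 z ≠ 0 := by
  obtain ⟨c, hc, h⟩ := exists_alpha4_pow_six_eq
  intro h0
  have := h z
  rw [h0, zero_pow (by norm_num)] at this
  exact mul_ne_zero hc (etaQuotient_ne_zero z) this.symm

theorem min_le_of_le_pow_six {ε x : ℝ} (hx : 0 ≤ x) (h : ε ≤ x ^ 6) : min 1 ε ≤ x := by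
  by_contra! hlt
  obtain ⟨h1, h2⟩ := lt_min_iff.1 hlt
  have := pow_le_of_le_one hx h1.le (n := 6) (by norm_num)
  linarith

theorem norm_alpha4_ge : ∃ ε : ℝ, 0 < ε ∧ ∀ᶠ z : ℍ in atImInfty,
    ε * Real.exp (-(2 * Real.pi * z.im)) ≤ ‖alpha4 z‖ := by
  obtain ⟨c, hc, h⟩ := exists_alpha4_pow_six_eq
  refine ⟨min 1 (‖c‖ / 8), by positivity, ?_⟩
  filter_upwards [norm_etaQuotient_ge] with z hz
  have hr := Real.exp_pos (-(2 * Real.pi * z.im))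
  set r := Real.exp (-(2 * Real.pi * z.im))
  rw [← le_div_iff₀ hr]
  refine min_le_of_le_pow_six (by positivity) ?_
  rw [div_pow, le_div_iff₀ (by positivity), ← norm_pow, h, norm_mul]
  calc ‖c‖ / 8 * r ^ 6 = ‖c‖ * (1 / 8 * r ^ 6) := by ring
    _ ≤ _ := by gcongr

theorem norm_slash_alpha4_ge {α : SL(2, ℤ)} (hα : α 1 0 % 4 ≠ 0) :
    ∃ ε : ℝ, 0 < ε ∧ ∀ᶠ z : ℍ in atImInfty,
      ε ≤ ‖(sqrtDenom α z ^ 4)⁻¹ * alpha4 (α • z)‖ := by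
  obtain ⟨c, hc, h⟩ := exists_alpha4_pow_six_eq
  obtain ⟨ε, hε, h1⟩ := norm_slash_etaQuotient_ge hα
  have hc' : 0 < ‖c‖ := norm_pos_iff.2 hc
  refine ⟨min 1 (‖c‖ * ε), by positivity, ?_⟩
  filter_upwards [h1] with z hz
  refine min_le_of_le_pow_six (norm_nonneg _) ?_
  rw [← norm_pow, mul_pow, h, inv_pow, show (sqrtDenom α z ^ 4) ^ 6 = (sqrtDenom α z ^ 2) ^ 12 by ring,
    sqrtDenom_sq, mul_left_comm, norm_mul]
  gcongr

/-- At every cusp, a form vanishing at `∞` is dominated by `α₄`. -/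
theorem exists_norm_slash_le_alpha4 {n : ℕ} {f : ℍ → ℂ} (hf : f ∈ M (Gamma1 4) n)
    (h0 : IsZeroAtImInfty f) (α : SL(2, ℤ)) :
    ∃ C : ℝ, ∀ᶠ z : ℍ in atImInfty, ‖(sqrtDenom α z ^ n)⁻¹ * f (α • z)‖ ≤
      C * ‖(sqrtDenom α z ^ 4)⁻¹ * alpha4 (α • z)‖ := by
  by_cases hα : α 1 0 % 4 = 0
  · obtain ⟨C, hC, h1⟩ := exists_norm_le_exp_of_isZero hf h0
    obtain ⟨ε, hε, h2⟩ := norm_alpha4_ge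
    refine ⟨C / ε, ?_⟩
    filter_upwards [h1, h2] with z h3 h4
    rw [norm_slash_of_four_dvd hf hα, norm_slash_of_four_dvd alpha4_mem hα]
    calc ‖f z‖ ≤ C * Real.exp (-(2 * Real.pi * z.im)) := h3
      _ = C / ε * (ε * Real.exp (-(2 * Real.pi * z.im))) := by field_simp
      _ ≤ _ := by gcongr
  · obtain ⟨K, hK, h1⟩ := (hf.2.2 α).exists_pos
    obtain ⟨ε, hε, h2⟩ := norm_slash_alpha4_ge hα
    refine ⟨K / ε, ?_⟩
    filter_upwards [h1.bound, h2] with z h3 h4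
    simp only [Pi.one_apply, norm_one, mul_one] at h3
    calc _ ≤ K := h3
      _ = K / ε * ε := by field_simp
      _ ≤ _ := by gcongr

/-- The integer exponent lets one bound serve both for `n ≥ 4` and for the negative weights that
occur when `n < 4`. -/
theorem norm_slash_div_le {n : ℕ} {f : ℍ → ℂ} (hf : f ∈ M (Gamma1 4) n)
    (h0 : IsZeroAtImInfty f) (α : SL(2, ℤ)) :
    ∃ C : ℝ, ∀ᶠ z : ℍ in atImInfty, ‖sqrtDenom α z ^ (4 - n : ℤ) *
      (f (α • z) / alpha4 (α • z))‖ ≤ C := by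
  obtain ⟨C, h⟩ := exists_norm_slash_le_alpha4 hf h0 α
  refine ⟨C, h.mono fun z hz => ?_⟩
  have hs := sqrtDenom_ne_zero α z
  have ha := alpha4_ne_zero (α • z)
  have hpos : 0 < ‖(sqrtDenom α z ^ 4)⁻¹ * alpha4 (α • z)‖ :=
    norm_pos_iff.2 (mul_ne_zero (inv_ne_zero (pow_ne_zero _ hs)) ha)
  rw [← div_le_iff₀ hpos, ← norm_div] at hz
  refine (congrArg norm ?_).trans_le hz
  rw [zpow_sub₀ hs, zpow_natCast, show (4 : ℤ) = ((4 : ℕ) : ℤ) by norm_num, zpow_natCast]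
  field_simp

theorem exists_eq_alpha4_mul {m : ℕ} {f : ℍ → ℂ} (hf : f ∈ M (Gamma1 4) (m + 4))
    (h0 : IsZeroAtImInfty f) : ∃ g ∈ M (Gamma1 4) m, f = alpha4 * g := by
  refine ⟨fun z => f z / alpha4 z, ⟨?_, fun γ hγ => ?_, fun α => ?_⟩, ?_⟩
  · exact mdifferentiable_div hf.1 mdifferentiable_alpha4 alpha4_ne_zero
  · refine slash_eq_of_apply_smul hγ fun z => ?_
    have hJ := J_ne_zero hγ z
    rw [apply_smul_of_slash_eq hγ (hf.2.1 γ hγ), apply_smul_of_slash_eq hγ (alpha4_mem.2.1 γ hγ),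
      pow_add, mul_right_comm, mul_comm (J γ z ^ m * f z), mul_div_mul_left _ _ (pow_ne_zero _ hJ),
      mul_div_assoc]
  · obtain ⟨C, h⟩ := norm_slash_div_le hf h0 α
    refine Asymptotics.IsBigO.of_bound C (h.mono fun z hz => ?_)
    rw [show (4 - (m + 4 : ℕ) : ℤ) = -(m : ℤ) by push_cast; ring, zpow_neg, zpow_natCast] at hz
    simpa using hz
  · ext z
    simp [mul_div_cancel₀ _ (alpha4_ne_zero z)]

/-- The quotient by `alpha4` may have half-integral weight; its square has integral weight `n - 4 <
0` and so vanishes. -/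
theorem eq_zero_of_isZeroAtImInfty {n : ℕ} (hn : n < 4) {f : ℍ → ℂ} (hf : f ∈ M (Gamma1 4) n)
    (h0 : IsZeroAtImInfty f) : f = 0 := by
  obtain ⟨g, hg⟩ := exists_modularForm_eq (k := (n : ℤ) - 4) (f := fun z => (f z / alpha4 z) ^ 2)
    ((mdifferentiable_div hf.1 mdifferentiable_alpha4 alpha4_ne_zero).pow 2)
    (fun γ hγ z => by
      have hJ := J_ne_zero hγ z
      rw [apply_smul_of_slash_eq hγ (hf.2.1 γ hγ), apply_smul_of_slash_eq hγ (alpha4_mem.2.1 γ hγ),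
        ← J_sq hγ, ← zpow_natCast (J γ z) 2, ← zpow_mul, mul_comm ((2 : ℕ) : ℤ), zpow_mul,
        zpow_natCast, zpow_sub₀ hJ, zpow_natCast, show (4 : ℤ) = ((4 : ℕ) : ℤ) by norm_num,
        zpow_natCast, ← mul_pow]
      congr 1
      have := alpha4_ne_zero z
      field_simp)
    (fun α => by
      obtain ⟨C, h⟩ := norm_slash_div_le hf h0 α
      refine Asymptotics.IsBigO.of_bound (C ^ 2) (h.mono fun z hz => ?_)
      have hs := sqrtDenom_ne_zero α z
      have e : ((((α 1 0 : ℂ) * z + α 1 1) ^ ((n : ℤ) - 4))⁻¹ *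
          (f (α • z) / alpha4 (α • z)) ^ 2) =
          (sqrtDenom α z ^ (4 - n : ℤ) * (f (α • z) / alpha4 (α • z))) ^ 2 := by
        rw [← sqrtDenom_sq, mul_pow, ← zpow_neg, neg_sub, ← zpow_natCast (sqrtDenom α z) 2,
          ← zpow_mul, mul_comm ((2 : ℕ) : ℤ), zpow_mul, zpow_natCast]
      simp only [Pi.one_apply, norm_one, mul_one]
      rw [e, norm_pow]
      gcongr)
  have hz := ModularForm.isZero_of_neg_weight (by omega) g
  ext z
  have h1 : (f z / alpha4 z) ^ 2 = 0 := by
    have := congrFun hg z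
    rw [← this, hz]; rfl
  rcases div_eq_zero_iff.1 (pow_eq_zero_iff two_ne_zero |>.1 h1) with h | h
  · exact h
  · exact absurd h (alpha4_ne_zero z)

theorem theta_pow_mem (n : ℕ) : theta ^ n ∈ M (Gamma1 4) n := by
  simpa using SetLike.pow_mem_graded n theta_mem

/-- A form of weight `n / 2` is a multiple of `ϑⁿ` plus a multiple of `α₄`. -/
theorem exists_eq_add {n : ℕ} {f : ℍ → ℂ} (hf : f ∈ M (Gamma1 4) n) :
    ∃ a : ℂ, f = a • theta ^ n ∨
      ∃ m, n = m + 4 ∧ ∃ g ∈ M (Gamma1 4) m, f = a • theta ^ n + alpha4 * g := by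
  obtain ⟨a, ha⟩ := exists_tendsto_atImInfty hf
  have hmem : f - a • theta ^ n ∈ M (Gamma1 4) n :=
    sub_mem hf (Submodule.smul_mem _ a (theta_pow_mem n))
  have h0 : IsZeroAtImInfty (f - a • theta ^ n) := by
    have := ha.sub ((tendsto_theta.pow n).const_mul a)
    rw [one_pow, mul_one, sub_self] at this
    exact this
  refine ⟨a, ?_⟩
  rcases lt_or_ge n 4 with hn | hn
  · left
    exact sub_eq_zero.1 (eq_zero_of_isZeroAtImInfty hn hmem h0)
  · right
    obtain ⟨m, rfl⟩ := Nat.exists_eq_add_of_le' hn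
    obtain ⟨g, hg, h⟩ := exists_eq_alpha4_mul hmem h0
    exact ⟨m, rfl, g, hg, by rw [← h]; abel⟩

end Division

/-! ### Directness of the sum, algebraic independence and generation. -/

section Algebra

/-- The element `(1 0; 4m 1)` of `Γ₁(4)`. -/
def lowerUnipotent (m : ℕ) : SL(2, ℤ) := ⟨!![1, 0; 4 * m, 1], by simp [Matrix.det_fin_two]⟩

theorem lowerUnipotent_mem (m : ℕ) : lowerUnipotent m ∈ Gamma1 4 := by
  rw [mem_Gamma1_four]; simp [lowerUnipotent]

theorem J_lowerUnipotent_injective (z : ℍ) :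
    Function.Injective fun m => J (lowerUnipotent m) z := by
  intro m m' h
  have h1 : J (lowerUnipotent m) z ^ 2 = J (lowerUnipotent m') z ^ 2 := congrArg (· ^ 2) h
  rw [J_sq (lowerUnipotent_mem m), J_sq (lowerUnipotent_mem m')] at h1
  have hz : (z : ℂ) ≠ 0 := ne_zero z
  simpa [lowerUnipotent, hz] using h1

/-- Forms of distinct weights are linearly independent. -/
theorem eq_zero_of_sum_eq_zero {s : Finset ℕ} {f : ℕ → ℍ → ℂ}
    (hf : ∀ i ∈ s, f i ∈ M (Gamma1 4) i) (h : ∑ i ∈ s, f i = 0) {i : ℕ} (hi : i ∈ s) :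
    f i = 0 := by
  ext z
  -- Evaluating the relation at `lowerUnipotent m • z` shows that every `J (lowerUnipotent m) z` is
  -- a root of `p`.
  let p : Polynomial ℂ := ∑ i ∈ s, Polynomial.monomial i (f i z)
  have hp : p = 0 := by
    refine Polynomial.eq_zero_of_infinite_isRoot p
      ((Set.infinite_range_of_injective (J_lowerUnipotent_injective z)).mono ?_)
    rintro _ ⟨m, rfl⟩
    change p.eval (J (lowerUnipotent m) z) = 0
    have h1 := congrFun h (lowerUnipotent m • z)
    rw [Finset.sum_apply] at h1
    rw [Polynomial.eval_finsetSum, ← Pi.zero_apply (M := fun _ : ℍ => ℂ) (lowerUnipotent m • z),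
      ← h1]
    refine Finset.sum_congr rfl fun i hi => ?_
    rw [Polynomial.eval_monomial, apply_smul_of_slash_eq (lowerUnipotent_mem m)
      ((hf i hi).2.1 _ (lowerUnipotent_mem m)), mul_comm]
  have hc : p.coeff i = f i z := by
    simp [p, Polynomial.coeff_monomial, hi]
  rw [← hc, hp]
  rfl

theorem coeAlgHom_injective :
    Function.Injective (DirectSum.coeAlgHom (M (Gamma1 4))) := by
  classical
  rw [injective_iff_map_eq_zero]
  intro x hx
  have hsum : ∑ i ∈ DFinsupp.support x, (x i : ℍ → ℂ) = 0 := by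
    rw [← hx]
    conv_rhs => rw [← DirectSum.sum_support_of x, map_sum]
    exact Finset.sum_congr rfl fun i _ => (DirectSum.coeAlgHom_of _ i (x i)).symm
  ext i : 1
  by_cases hi : i ∈ DFinsupp.support x
  · exact Subtype.ext (eq_zero_of_sum_eq_zero (fun i _ => (x i).2) hsum hi)
  · exact DFinsupp.notMem_support_iff.1 hi

theorem aeval_eq_sum (p : MvPolynomial (Fin 2) ℂ) :
    MvPolynomial.aeval ![theta, alpha4] p =
      ∑ d ∈ p.support, p.coeff d • (theta ^ d 0 * alpha4 ^ d 1) := by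
  rw [MvPolynomial.aeval_def, MvPolynomial.eval₂_eq']
  refine Finset.sum_congr rfl fun d _ => ?_
  rw [Fin.prod_univ_two, Algebra.smul_def]
  rfl

theorem monomial_mem (a b : ℕ) : theta ^ a * alpha4 ^ b ∈ M (Gamma1 4) (a + 4 * b) := by
  have h := SetLike.pow_mem_graded b alpha4_mem
  rw [smul_eq_mul, mul_comm] at h
  exact SetLike.mul_mem_graded (theta_pow_mem a) h

theorem weight_eq (d : Fin 2 →₀ ℕ) :
    Finsupp.weight (![1, 4] : Fin 2 → ℕ) d = d 0 + 4 * d 1 := by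
  rw [Finsupp.weight_apply, Finsupp.sum_fintype _ _ (by simp), Fin.sum_univ_two]
  simp [mul_comm]

theorem aeval_mem {n : ℕ} {p : MvPolynomial (Fin 2) ℂ}
    (hp : MvPolynomial.IsWeightedHomogeneous (![1, 4] : Fin 2 → ℕ) p n) :
    MvPolynomial.aeval ![theta, alpha4] p ∈ M (Gamma1 4) n := by
  rw [aeval_eq_sum]
  refine sum_mem fun d hd => Submodule.smul_mem _ _ ?_
  have h := hp (MvPolynomial.mem_support_iff.1 hd)
  rw [weight_eq] at h
  rw [← h]
  exact monomial_mem _ _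

/-- The functions `ϑ` and `α₄` are algebraically independent. -/
theorem aeval_injective :
    Function.Injective (MvPolynomial.aeval (R := ℂ) ![theta, alpha4]) := by
  classical
  rw [injective_iff_map_eq_zero]
  intro p hp
  by_contra hne
  obtain ⟨d₀, hd₀⟩ := MvPolynomial.support_nonempty.2 hne
  set n := d₀ 0 + 4 * d₀ 1 with hn
  -- Directness allows the relation to be restricted to the monomials of a single weight.
  set s := p.support.filter fun d => d 0 + 4 * d 1 = n with hs
  have hsum : ∑ d ∈ s, p.coeff d • (theta ^ d 0 * alpha4 ^ d 1) = 0 := by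
    rw [aeval_eq_sum, ← Finset.sum_fiberwise_of_maps_to
      (t := p.support.image fun d => d 0 + 4 * d 1) (g := fun d => d 0 + 4 * d 1)
      fun d hd => Finset.mem_image_of_mem _ hd] at hp
    refine eq_zero_of_sum_eq_zero (f := fun n => ∑ d ∈ p.support.filter fun d => d 0 + 4 * d 1 = n,
      p.coeff d • (theta ^ d 0 * alpha4 ^ d 1)) (fun i _ => ?_) hp
      (Finset.mem_image_of_mem (fun d : Fin 2 →₀ ℕ => d 0 + 4 * d 1) hd₀)
    refine sum_mem fun d hd => Submodule.smul_mem _ _ ?_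
    rw [← (Finset.mem_filter.1 hd).2]
    exact monomial_mem _ _
  obtain ⟨e, he, hmin⟩ := Finset.exists_min_image s (fun d => d 1)
    ⟨d₀, Finset.mem_filter.2 ⟨hd₀, hn.symm⟩⟩
  -- After division by the least power of `alpha4`, only the monomial `e` survives in the limit at
  -- `∞`: within one weight, the exponent of `alpha4` determines that of `theta`.
  have hquot (z : ℍ) :
      ∑ d ∈ s, p.coeff d * (theta z ^ d 0 * alpha4 z ^ (d 1 - e 1)) = 0 := by
    have h := congrFun hsum z
    refine (mul_eq_zero.1 ?_).resolve_left (pow_ne_zero (e 1) (alpha4_ne_zero z))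
    rw [← Pi.zero_apply (M := fun _ : ℍ => ℂ) z, ← h, Finset.mul_sum, Finset.sum_apply]
    refine Finset.sum_congr rfl fun d hd => ?_
    simp only [Pi.smul_apply, Pi.mul_apply, Pi.pow_apply, smul_eq_mul]
    conv_rhs => rw [← Nat.add_sub_cancel' (hmin d hd), pow_add]
    ring
  have hlim : Filter.Tendsto
      (fun z => ∑ d ∈ s, p.coeff d * (theta z ^ d 0 * alpha4 z ^ (d 1 - e 1))) atImInfty
      (nhds (∑ d ∈ s, p.coeff d * (1 ^ d 0 * 0 ^ (d 1 - e 1)))) :=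
    tendsto_finsetSum _ fun d _ =>
      ((tendsto_theta.pow _).mul (isZeroAtImInfty_alpha4.pow _)).const_mul _
  simp only [hquot] at hlim
  have hval := tendsto_nhds_unique hlim tendsto_const_nhds
  rw [Finset.sum_eq_single e] at hval
  · simp only [one_pow, Nat.sub_self, pow_zero, mul_one] at hval
    exact MvPolynomial.mem_support_iff.1 (Finset.mem_filter.1 he).1 hval
  · intro d hd hde
    have h1 : e 1 ≤ d 1 := hmin d hd
    have h2 : d 1 ≠ e 1 := by
      intro h
      apply hde
      have ha := (Finset.mem_filter.1 hd).2
      have hb := (Finset.mem_filter.1 he).2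
      ext i
      fin_cases i
      · change d 0 = e 0
        omega
      · exact h
    rw [zero_pow (by omega), mul_zero, mul_zero]
  · exact fun h => absurd he h

theorem exists_homogeneous_aeval_eq {n : ℕ} {f : ℍ → ℂ} (hf : f ∈ M (Gamma1 4) n) :
    ∃ p : MvPolynomial (Fin 2) ℂ,
      MvPolynomial.IsWeightedHomogeneous (![1, 4] : Fin 2 → ℕ) p n ∧
        MvPolynomial.aeval ![theta, alpha4] p = f := by
  induction n using Nat.strong_induction_on generalizing f with
  | _ n ih =>
  have hX (a : ℂ) : MvPolynomial.IsWeightedHomogeneous (![1, 4] : Fin 2 → ℕ)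
      (MvPolynomial.C a * MvPolynomial.X 0 ^ n) n := by
    have h1 := MvPolynomial.isWeightedHomogeneous_C (![1, 4] : Fin 2 → ℕ) a
    have h2 := (MvPolynomial.isWeightedHomogeneous_X ℂ (![1, 4] : Fin 2 → ℕ) 0).pow n
    simpa using h1.mul h2
  have hXeval (a : ℂ) : MvPolynomial.aeval ![theta, alpha4]
      (MvPolynomial.C a * MvPolynomial.X 0 ^ n) = a • theta ^ n := by
    simp [Algebra.smul_def]
  obtain ⟨a, h | ⟨m, rfl, g, hg, h⟩⟩ := exists_eq_add hf
  · exact ⟨MvPolynomial.C a * MvPolynomial.X 0 ^ n, hX a, by rw [hXeval, h]⟩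
  · obtain ⟨p, hp, hpg⟩ := ih m (by omega) hg
    refine ⟨MvPolynomial.C a * MvPolynomial.X 0 ^ (m + 4) + MvPolynomial.X 1 * p,
      (hX a).add ?_, by rw [map_add, hXeval, map_mul, hpg, h]; simp⟩
    have h1 := (MvPolynomial.isWeightedHomogeneous_X ℂ (![1, 4] : Fin 2 → ℕ) 1).mul hp
    rwa [show (![1, 4] : Fin 2 → ℕ) 1 + m = m + 4 by simp [add_comm]] at h1

/-- Removing `alpha4` lowers the index by `4` and keeps it odd, so the induction stays within odd
indices, where `theta ^ (2k + 1)` has the factor `theta`. -/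
theorem exists_eq_mul_theta {k : ℕ} {f : ℍ → ℂ} (hf : f ∈ M (Gamma1 4) (2 * k + 1)) :
    ∃ g ∈ M (Gamma1 4) (2 * k), f = g * theta := by
  induction k using Nat.strong_induction_on generalizing f with
  | _ k ih =>
  have hθ (a : ℂ) : a • theta ^ (2 * k) ∈ M (Gamma1 4) (2 * k) :=
    Submodule.smul_mem _ a (theta_pow_mem _)
  obtain ⟨a, h | ⟨m, hm, g, hg, h⟩⟩ := exists_eq_add hf
  · exact ⟨_, hθ a, by rw [h, pow_succ, smul_mul_assoc]⟩
  · obtain ⟨j, rfl⟩ : ∃ j, k = j + 2 := ⟨k - 2, by omega⟩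
    obtain rfl : m = 2 * j + 1 := by omega
    obtain ⟨g', hg', rfl⟩ := ih j (by omega) hg
    refine ⟨_, add_mem (hθ a) (?_ : alpha4 * g' ∈ _), ?_⟩
    · have := SetLike.mul_mem_graded alpha4_mem hg'
      rwa [show 4 + 2 * j = 2 * (j + 2) by ring] at this
    · rw [h, add_mul, pow_succ, smul_mul_assoc, mul_assoc]

end Algebra

end HalfIntegralWeight

/-! ### The main theorem. -/

open HalfIntegralWeight in
theorem mainTheorem11 :
    -- the sum of the spaces `M_κ(Γ₁(4))`, `κ ∈ ½ℕ`, is direct inside the ring of functions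
    Function.Injective (DirectSum.coeAlgHom (HalfIntegralWeight.M (Gamma1 4))) ∧
    -- the graded ring `⨁ M_κ(Γ₁(4))` is the polynomial ring in `ϑ` (weight `1/2`) and `α₄` (weight `2`)
    (∃ (hθ : HalfIntegralWeight.theta ∈ HalfIntegralWeight.M (Gamma1 4) 1)
       (hα : HalfIntegralWeight.alpha4 ∈ HalfIntegralWeight.M (Gamma1 4) 4)
       (e : MvPolynomial (Fin 2) ℂ ≃ₐ[ℂ] ⨁ n, HalfIntegralWeight.M (Gamma1 4) n),
       e (MvPolynomial.X 0) = DirectSum.of (fun n => HalfIntegralWeight.M (Gamma1 4) n) 1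
         ⟨HalfIntegralWeight.theta, hθ⟩ ∧
       e (MvPolynomial.X 1) = DirectSum.of (fun n => HalfIntegralWeight.M (Gamma1 4) n) 4
         ⟨HalfIntegralWeight.alpha4, hα⟩ ∧
       ∀ (n : ℕ) (p : MvPolynomial (Fin 2) ℂ),
         MvPolynomial.IsWeightedHomogeneous (![1, 4] : Fin 2 → ℕ) p n ↔
           ∃ f : HalfIntegralWeight.M (Gamma1 4) n,
             e p = DirectSum.of (fun n => HalfIntegralWeight.M (Gamma1 4) n) n f) ∧
    -- `M_{k+1/2}(Γ₁(4)) = M_k(Γ₁(4)) ϑ`, with `M_k` the usual space of integral weight `k`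
    ∀ k : ℕ, (HalfIntegralWeight.M (Gamma1 4) (2 * k + 1) : Set (ℍ → ℂ)) =
      {f | ∃ g : ModularForm (Gamma1 4) (k : ℤ), f = ⇑g * HalfIntegralWeight.theta} := by
  classical
  refine ⟨coeAlgHom_injective, ?_, fun k => ?_⟩
  · let Θ := DirectSum.of (fun n => M (Gamma1 4) n) 1 ⟨theta, theta_mem⟩
    let A := DirectSum.of (fun n => M (Gamma1 4) n) 4 ⟨alpha4, alpha4_mem⟩
    let φ : MvPolynomial (Fin 2) ℂ →ₐ[ℂ] ⨁ n, M (Gamma1 4) n := MvPolynomial.aeval ![Θ, A]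
    -- Identities in the direct sum are checked among functions on `ℍ`, by injectivity of
    -- `coeAlgHom`.
    have hcoe (p) : DirectSum.coeAlgHom (M (Gamma1 4)) (φ p) =
        MvPolynomial.aeval ![theta, alpha4] p := by
      have : (DirectSum.coeAlgHom (M (Gamma1 4))).comp φ =
          MvPolynomial.aeval ![theta, alpha4] := by
        apply MvPolynomial.algHom_ext
        intro i
        fin_cases i <;> simp [φ, Θ, A]
      exact DFunLike.congr_fun this p
    have hof {n : ℕ} {p} {f : M (Gamma1 4) n}
        (h : MvPolynomial.aeval ![theta, alpha4] p = (f : ℍ → ℂ)) :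
        φ p = DirectSum.of (fun n => M (Gamma1 4) n) n f := by
      apply coeAlgHom_injective
      rw [hcoe, h, DirectSum.coeAlgHom_of]
    have hinj : Function.Injective φ := fun p q h => by
      apply aeval_injective
      rw [← hcoe, ← hcoe, h]
    have hsurj : Function.Surjective φ := fun x => by
      choose p hp using fun i => exists_homogeneous_aeval_eq (x i).2
      refine ⟨∑ i ∈ DFinsupp.support x, p i, ?_⟩
      rw [map_sum]
      conv_rhs => rw [← DirectSum.sum_support_of x]
      exact Finset.sum_congr rfl fun i _ => hof (hp i).2
    refine ⟨theta_mem, alpha4_mem, AlgEquiv.ofBijective φ ⟨hinj, hsurj⟩, ?_, ?_, fun n p => ?_⟩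
    · exact hof (by simp)
    · exact hof (by simp)
    · constructor
      · exact fun hp => ⟨⟨_, aeval_mem hp⟩, hof rfl⟩
      · rintro ⟨f, hf⟩
        -- The component `f` also has a weighted homogeneous preimage, which injectivity identifies
        -- with `p`.
        obtain ⟨p', hp', h⟩ := exists_homogeneous_aeval_eq f.2
        have : p = p' := hinj (by rw [hof h]; exact hf)
        rwa [this]
  · ext f
    constructor
    · intro hf
      obtain ⟨g, hg, rfl⟩ := exists_eq_mul_theta hf
      obtain ⟨g', rfl⟩ := (mem_M_two_mul_iff k g).1 hg
      exact ⟨g', rfl⟩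
    · rintro ⟨g, rfl⟩
      exact SetLike.mul_mem_graded ((mem_M_two_mul_iff k g).2 ⟨g, rfl⟩) theta_mem
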